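/- Let $\nu$ be a positive integer, $b>0$ and $\alpha<1$. Put $p=\frac1{1-\alpha}$, $d=\frac1{1-\alpha}$ and $z=\frac{(1-\alpha)b^2}{4}$. Write $(a)_r=a(a+1)\cdots(a+r-1)$, $(a)_0=1$, $\psi=\Gamma'/\Gamma$, and ${}_1F_2(a;b_1,b_2;x)=\sum_{r\ge0}\frac{(a)_r}{(b_1)_r(b_2)_r\,r!}x^r$. Then the cut-off extended integral $$I_{2\alpha}^{(d)}=\int_0^d x^{\nu}\,[1-(1-\alpha)x]^{\frac1{1-\alpha}}\,e^{-bx^{-1/2}}\,dx$$ has an integrable integrand, and $$I_{2\alpha}^{(d)}=\frac{\Gamma(p+1)}{\sqrt\pi\,(1-\alpha)^{\nu+1}}\Bigg\{\frac{\sqrt\pi\,\Gamma(1+\nu)}{\Gamma(2+\nu+p)}\sum_{r=0}^{\nu}\frac{(-1-\nu-p)_r}{(\frac12)_r(-\nu)_r\,r!}z^r-\frac{2\sqrt\pi\,\Gamma(\frac12+\nu)}{\Gamma(\frac32+\nu+p)}\,z^{1/2}\,{}_1F_2\Big(-\tfrac12-\nu-p;\tfrac32,\tfrac12-\nu;z\Big)+z^{1+\nu}\sum_{r=0}^{\infty}z^r\,[-\ln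 z+E_r]\,F_r\Bigg\},$$ where both infinite series converge (absolutely) and $$E_r=\psi\big(-\tfrac12-\nu-r\big)-\psi(p+1-r)+\psi(1+r)+\psi(2+\nu+r),$$ $$F_r=\frac{(-1)^r(-1)^{1+\nu+r}\,\Gamma(-\frac12-\nu)\,(-p)_r}{(\frac32+\nu)_r\;r!\,(1+\nu+r)!\;\Gamma(p+1)}.$$ If $p=N$ is a positive integer, then for $r>N$ one has $F_r=0$ while $\psi(p+1-r)$ has a pole; for these $r$ the product $[-\ln z+E_r]F_r$ is to be read as its limit as $p\to N$ (with $z$ fixed), and this limit exists and equals $$\frac{(-1)^{\nu+N}\,\Gamma(-\frac12-\nu)\,(r-N-1)!}{(\frac32+\nu)_r\;r!\,(1+\nu+r)!}.$$ -/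

import Mathlib

noncomputable section

namespace CutoffThermonuclear

/-- The rising factorial `(a)_r = a (a + 1) ⋯ (a + r - 1)`, with `(a)_0 = 1`. -/
def poch (a : ℝ) (r : ℕ) : ℝ := (ascPochhammer ℝ r).eval a

/-- The psi function on the real line (the logarithmic derivative of the Gamma function). -/
def psi (x : ℝ) : ℝ := (Complex.digamma (x : ℂ)).re

/-- The `r`-th term of the hypergeometric series `₁F₂(a; b, c; x)`. -/
def hyp12Term (a b c x : ℝ) (r : ℕ) : ℝ :=
  poch a r / (poch b r * poch c r * (r.factorial : ℝ)) * x ^ r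

/-- The generalized hypergeometric function `₁F₂(a; b, c; x)`. -/
def hyp12 (a b c x : ℝ) : ℝ := ∑' r : ℕ, hyp12Term a b c x r

/-- The integrand `x ^ ν * [1 - (1 - α) x] ^ (1 / (1 - α)) * exp (-b x ^ (-1/2))`. -/
def integrand (ν : ℕ) (α b x : ℝ) : ℝ :=
  x ^ ν * (1 - (1 - α) * x) ^ (1 / (1 - α)) * Real.exp (-b * x ^ (-(1 / 2) : ℝ))

/-- The cut-off extended integral: the integral over `[0, d]` with `d = 1 / (1 - α)`. -/
def cutoffIntegral (ν : ℕ) (α b : ℝ) : ℝ :=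
  ∫ x in (0 : ℝ)..(1 / (1 - α)), integrand ν α b x

/-- The argument `z = (1 - α) b² / 4`. -/
def zArg (α b : ℝ) : ℝ := (1 - α) * b ^ 2 / 4

/-- The common factor `Γ(1/(1-α) + 1) / (√π (1-α)^(ν+1))`. -/
def prefactor (ν : ℕ) (α : ℝ) : ℝ :=
  Real.Gamma (1 / (1 - α) + 1) / (Real.sqrt Real.pi * (1 - α) ^ (ν + 1))

/-- The finite sum. -/
def finitePart (ν : ℕ) (α z : ℝ) : ℝ :=
  Real.sqrt Real.pi * Real.Gamma (1 + (ν : ℝ)) / Real.Gamma (2 + (ν : ℝ) + 1 / (1 - α)) *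
    ∑ r ∈ Finset.range (ν + 1),
      poch (-1 - (ν : ℝ) - 1 / (1 - α)) r /
        (poch (1 / 2) r * poch (-(ν : ℝ)) r * (r.factorial : ℝ)) * z ^ r

/-- The (subtracted) `₁F₂` part. -/
def hypPart (ν : ℕ) (α z : ℝ) : ℝ :=
  2 * Real.sqrt Real.pi * Real.Gamma (1 / 2 + (ν : ℝ)) /
      Real.Gamma (3 / 2 + (ν : ℝ) + 1 / (1 - α)) * Real.sqrt z *
    hyp12 (-(1 / 2) - (ν : ℝ) - 1 / (1 - α)) (3 / 2) (1 / 2 - (ν : ℝ)) z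

/-- The coefficient `E_r`. -/
def coeffE (ν : ℕ) (α : ℝ) (r : ℕ) : ℝ :=
  psi (-(1 / 2) - (ν : ℝ) - r) - psi (1 / (1 - α) + 1 - r) + psi (1 + r) + psi (2 + (ν : ℝ) + r)

/-- The coefficient `F_r`. -/
def coeffF (ν : ℕ) (α : ℝ) (r : ℕ) : ℝ :=
  (-1) ^ r * (-1) ^ (1 + ν + r) * Real.Gamma (-(1 / 2) - (ν : ℝ)) * poch (-(1 / (1 - α))) r /
    (poch (3 / 2 + (ν : ℝ)) r * (r.factorial : ℝ) * ((1 + ν + r).factorial : ℝ) *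
      Real.Gamma (1 / (1 - α) + 1))

/-- The `r`-th term `z ^ r [-ln z + E_r] F_r` of the logarithmic series. -/
def logTerm (ν : ℕ) (α z : ℝ) (r : ℕ) : ℝ :=
  z ^ r * ((-Real.log z + coeffE ν α r) * coeffF ν α r)

/-- The value of the `r`-th term of the logarithmic series when `1 / (1 - α)` is the positive
integer `N` and `r > N`. There `F_r = 0` while `ψ(N + 1 - r)` is at a pole, so that the product
is replaced by its limit as `1 / (1 - α)` tends to `N`, which is
`z ^ r (-1)^(ν+N) Γ(-1/2-ν) (r-N-1)! / ((3/2+ν)_r r! (1+ν+r)!)`. -/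
def degenerateTerm (ν N : ℕ) (z : ℝ) (r : ℕ) : ℝ :=
  z ^ r * ((-1) ^ (ν + N) * Real.Gamma (-(1 / 2) - (ν : ℝ)) * ((r - N - 1).factorial : ℝ) /
    (poch (3 / 2 + (ν : ℝ)) r * (r.factorial : ℝ) * ((1 + ν + r).factorial : ℝ)))

/-- The `r`-th term of the logarithmic series when `1 / (1 - α)` is the positive integer `N`. -/
def logTermInt (ν N : ℕ) (α z : ℝ) (r : ℕ) : ℝ :=
  if r ≤ N then logTerm ν α z r else degenerateTerm ν N z r

end CutoffThermonuclear

end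

noncomputable section

namespace CutoffThermonuclear

open Filter MeasureTheory Set Topology

/-! ### Pochhammer symbols and binomial coefficients -/

/-! The substitution `x = t / (1 - α)` turns the integral into a multiple of `∫₀¹ (1 - t)^p t^ν
exp(-c t^(-1/2)) dt` with `c = 2√z`. Since `p > 0`, the binomial series `(1 - t)^p = ∑ a_j t^j`
converges absolutely up to `t = 1` and may be integrated termwise. With `t = u⁻²`, each term becomes
a generalized exponential integral, whose expansion in `c` (`expInt_eq`) is a logarithmic term plus
a series in the coefficients `e_k` of `exp(-c t)`.

There remains the absolutely convergent double sum of `a_j e_k / (ν + 1 + j - k/2)`, where the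
convention `x / 0 = 0` discards exactly the resonant pairs, which are the source of the logarithmic
terms. Summing over `j` first (`hasSum_log_part`) gives `e_k` times `binomFrac p x` at `x = ν + 1 -
k/2`. This is the Beta function where it is regular, and its finite part at a pole. Odd `k` give the
`₁F₂` series, `k = 2r ≤ 2ν` the finite sum, and `k = 2(ν + 1 + r)`, that is `x = -r`, digamma values
(`binomFrac_neg_nat`) which join the logarithmic terms to form `logForm`.

`logForm` is continuous in `p`, also at integers, although its factorization through `ψ(p + 1 - r)`
breaks down there. This yields the degenerate terms and their limits. -/

lemma poch_zero (a : ℝ) : poch a 0 = 1 := by simp [poch]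

lemma poch_succ (a : ℝ) (r : ℕ) : poch a (r + 1) = poch a r * (a + r) := by
  simp [poch, ascPochhammer_succ_eval]

/-- The coefficient of `t ^ j` in the expansion of `(1 - t) ^ p`. -/
def binomCoeff (p : ℝ) (j : ℕ) : ℝ := poch (-p) j / (j.factorial : ℝ)

lemma binomCoeff_zero (p : ℝ) : binomCoeff p 0 = 1 := by simp [binomCoeff, poch_zero]

lemma binomCoeff_succ (p : ℝ) (j : ℕ) :
    binomCoeff p (j + 1) = binomCoeff p j * (j - p) / (j + 1) := by
  have : (j.factorial : ℝ) ≠ 0 := by positivity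
  simp only [binomCoeff, poch_succ, Nat.factorial_succ]
  push_cast
  field_simp
  ring

/-- Telescoping: beyond `p`, the recurrence for the coefficients reads `p |a_j| = j |a_j| - (j + 1)
|a_(j+1)|`, so the partial sums stay bounded. -/
lemma summable_abs_binomCoeff {p : ℝ} (hp : 0 < p) : Summable fun j => |binomCoeff p j| := by
  obtain ⟨M, hM⟩ := exists_nat_ge p
  rw [← summable_nat_add_iff M]
  have key : ∀ j : ℕ, p * |binomCoeff p (j + M)| =
      (j + M) * |binomCoeff p (j + M)| - (j + 1 + M) * |binomCoeff p (j + 1 + M)| := by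
    intro j
    have h1 : (0 : ℝ) < (j : ℝ) + M + 1 := by positivity
    have h2 : (0 : ℝ) ≤ (j : ℝ) + M - p := by have : (0 : ℝ) ≤ j := by positivity
                                              linarith
    rw [show j + 1 + M = j + M + 1 by ring, binomCoeff_succ, abs_div, abs_mul]
    push_cast
    rw [abs_of_nonneg h2, abs_of_pos h1]
    field_simp
    ring
  have : Summable fun j => p * |binomCoeff p (j + M)| := by
    refine summable_of_sum_range_le (c := (M : ℝ) * |binomCoeff p M|)
      (fun j => by positivity) fun n => ?_
    have : ∑ j ∈ Finset.range n, p * |binomCoeff p (j + M)| =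
        M * |binomCoeff p M| - (n + M) * |binomCoeff p (n + M)| := by
      induction n with
      | zero => simp
      | succ n ih => rw [Finset.sum_range_succ, ih, key]; push_cast; ring
    rw [this]
    have : (0 : ℝ) ≤ (n + M) * |binomCoeff p (n + M)| := by positivity
    linarith
  exact (summable_mul_left_iff hp.ne').1 this

lemma ringChoose_eq_binomCoeff (p : ℝ) (n : ℕ) :
    Ring.choose (-p + n - 1) n = binomCoeff p n := by
  have h := Ring.factorial_nsmul_multichoose_eq_ascPochhammer (-p) n
  rw [Ring.multichoose_eq] at h
  have h0 : (n.factorial : ℝ) ≠ 0 := by positivity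
  rw [binomCoeff, eq_div_iff h0, poch, ← Polynomial.ascPochhammer_smeval_eq_eval, ← h]
  simp [mul_comm]

lemma hasSum_binomCoeff_mul_pow_of_lt {p t : ℝ} (ht0 : 0 ≤ t) (ht : t < 1) :
    HasSum (fun j => binomCoeff p j * t ^ j) ((1 - t) ^ p) := by
  have h := Real.one_div_one_sub_rpow_hasFPowerSeriesOnBall_zero (-p)
  have := h.hasSum (y := t) (by simp [enorm_eq_nnnorm, ← NNReal.coe_lt_coe, abs_of_nonneg ht0, ht])
  simp only [zero_add, Real.rpow_neg (by linarith : (0 : ℝ) ≤ 1 - t), one_div, inv_inv] at this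
  simpa [ringChoose_eq_binomCoeff, mul_comm] using this

lemma continuousOn_tsum_mul_pow {a : ℕ → ℝ} (ha : Summable fun j => |a j|) :
    ContinuousOn (fun t : ℝ => ∑' j, a j * t ^ j) (Icc 0 1) := by
  refine continuousOn_tsum (fun j => by fun_prop) ha fun j t ht => ?_
  rw [Real.norm_eq_abs, abs_mul, abs_pow, abs_of_nonneg ht.1]
  exact mul_le_of_le_one_right (abs_nonneg _) (pow_le_one₀ ht.1 ht.2)

/-- Both sides are continuous on `[0, 1]` and agree on `[0, 1)`, which settles the endpoint `t = 1`.
-/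
lemma tsum_binomCoeff_mul_pow {p t : ℝ} (hp : 0 < p) (ht : t ∈ Icc (0 : ℝ) 1) :
    ∑' j, binomCoeff p j * t ^ j = (1 - t) ^ p := by
  have hc := continuousOn_tsum_mul_pow (summable_abs_binomCoeff hp)
  have hd : ContinuousOn (fun t : ℝ => (1 - t) ^ p) (Icc 0 1) :=
    (continuous_const.sub continuous_id).continuousOn.rpow_const fun _ _ => Or.inr hp.le
  have heq : EqOn (fun t : ℝ => ∑' j, binomCoeff p j * t ^ j) (fun t => (1 - t) ^ p) (Ico 0 1) :=
    fun t ht => (hasSum_binomCoeff_mul_pow_of_lt ht.1 ht.2).tsum_eq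
  exact heq.of_subset_closure hc hd Ico_subset_Icc_self
    (by rw [closure_Ico (by norm_num)]) ht

/-! ### The psi function -/

lemma differentiableAt_Gamma_of_re_pos {s : ℂ} (hs : 0 < s.re) :
    DifferentiableAt ℂ Complex.Gamma s :=
  Complex.differentiableAt_Gamma s fun m h => by
    rw [h, Complex.neg_re, Complex.natCast_re] at hs
    have : (0 : ℝ) ≤ m := by positivity
    linarith

lemma psi_add_one {x : ℝ} (hx : ∀ m : ℕ, x ≠ -m) : psi (x + 1) = psi x + 1 / x := by
  have := Complex.digamma_apply_add_one (x : ℂ) (fun m h => hx m (by exact_mod_cast h))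
  simp only [psi, Complex.ofReal_add, Complex.ofReal_one, this, Complex.add_re, one_div]
  rw [← Complex.ofReal_inv, Complex.ofReal_re]

lemma psi_add_one_of_pos {x : ℝ} (hx : 0 < x) : psi (x + 1) = psi x + 1 / x :=
  psi_add_one fun m h => by
    have : (0 : ℝ) ≤ m := by positivity
    linarith

lemma psi_one : psi 1 = -Real.eulerMascheroniConstant := by
  simp [psi, Complex.digamma_one]

lemma psi_one_half : psi (1 / 2) = -2 * Real.log 2 - Real.eulerMascheroniConstant := by
  have : Complex.log 2 = (Real.log 2 : ℂ) := by
    rw [← Complex.ofReal_ofNat, ← Complex.ofReal_log (by norm_num)]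
  have h := Complex.digamma_one_half
  simp only [psi]
  push_cast
  rw [h, this, ← Complex.ofReal_ofNat, ← Complex.ofReal_neg, ← Complex.ofReal_mul,
    ← Complex.ofReal_sub, Complex.ofReal_re]

lemma hasDerivAt_Gamma {x : ℝ} (hx : 0 < x) :
    HasDerivAt Real.Gamma (psi x * Real.Gamma x) x := by
  have hd : DifferentiableAt ℂ Complex.Gamma (x : ℂ) :=
    differentiableAt_Gamma_of_re_pos (by simpa using hx)
  have h := hd.hasDerivAt.real_of_complex
  change HasDerivAt Real.Gamma (deriv Complex.Gamma x).re x at h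
  convert h using 1
  have h0 : Complex.Gamma (x : ℂ) ≠ 0 := Complex.Gamma_ne_zero_of_re_pos (by simpa using hx)
  have : deriv Complex.Gamma x = Complex.digamma x * (Real.Gamma x : ℂ) := by
    rw [Complex.digamma_def, logDeriv_apply, ← Complex.Gamma_ofReal, div_mul_cancel₀ _ h0]
  rw [this, Complex.re_mul_ofReal, psi]

lemma continuousAt_psi {x : ℝ} (hx : 0 < x) : ContinuousAt psi x := by
  have hU : IsOpen {s : ℂ | 0 < s.re} := isOpen_lt continuous_const Complex.continuous_re
  have hd : DifferentiableOn ℂ Complex.Gamma {s : ℂ | 0 < s.re} := fun s hs =>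
    (differentiableAt_Gamma_of_re_pos hs).differentiableWithinAt
  have hx' : (x : ℂ) ∈ {s : ℂ | 0 < s.re} := by simpa using hx
  have h1 : ContinuousAt (deriv Complex.Gamma) (x : ℂ) :=
    ((hd.deriv hU).differentiableAt (hU.mem_nhds hx')).continuousAt
  have h2 : ContinuousAt Complex.Gamma (x : ℂ) := (hd.differentiableAt (hU.mem_nhds hx')).continuousAt
  have h3 : ContinuousAt Complex.digamma (x : ℂ) :=
    h1.div h2 (Complex.Gamma_ne_zero_of_re_pos hx')
  exact Complex.continuous_re.continuousAt.comp
    (h3.comp_of_eq Complex.continuous_ofReal.continuousAt rfl)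

/-- The reflection formula at half-integers, where the cotangent term vanishes; it brings `ψ(-1/2 -
ν - r)` in `coeffE` to a positive argument. -/
lemma psi_half_sub_nat (n : ℕ) : psi (1 / 2 - n) = psi (1 / 2 + n) := by
  induction n with
  | zero => simp
  | succ n ih =>
    have h1 := psi_add_one (x := 1 / 2 - (n + 1 : ℕ)) fun m h => by
      have : (1 : ℝ) + 2 * m = 2 * (n + 1 : ℕ) := by linarith
      norm_cast at this
      omega
    have h2 := psi_add_one_of_pos (x := 1 / 2 + n) (by positivity)
    rw [show (1 : ℝ) / 2 - (n + 1 : ℕ) + 1 = 1 / 2 - n by push_cast; ring, ih] at h1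
    rw [show (1 : ℝ) / 2 + (n + 1 : ℕ) = 1 / 2 + n + 1 by push_cast; ring, h2, h1]
    have h3 : (1 : ℝ) / 2 - (n + 1 : ℕ) = -(1 / 2 + n) := by push_cast; ring
    rw [h3, div_neg]
    ring

/-- Legendre duplication at integers. It splits the single digamma value in the exponential integral
into the two appearing in `coeffE`. -/
lemma psi_two_mul_add_one (m : ℕ) :
    2 * psi (2 * m + 1) = psi (1 / 2 + m) + psi (1 + m) + 2 * Real.log 2 := by
  induction m with
  | zero => norm_num [psi_one, psi_one_half]; ring
  | succ m ih =>
    have h1 := psi_add_one_of_pos (x := 2 * m + 1) (by positivity)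
    have h2 := psi_add_one_of_pos (x := 2 * m + 1 + 1) (by positivity)
    have h3 := psi_add_one_of_pos (x := 1 / 2 + m) (by positivity)
    have h4 := psi_add_one_of_pos (x := 1 + m) (by positivity)
    rw [show (2 : ℝ) * (m + 1 : ℕ) + 1 = 2 * m + 1 + 1 + 1 by push_cast; ring,
      show (1 : ℝ) / 2 + (m + 1 : ℕ) = 1 / 2 + m + 1 by push_cast; ring,
      show (1 : ℝ) + (m + 1 : ℕ) = 1 + m + 1 by push_cast; ring, h2, h1, h3, h4,
      mul_add, mul_add, ih]
    field_simp
    ring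

/-! ### Sums of partial fractions -/

lemma hasSum_integral_tsum_mul_pow {a : ℕ → ℝ} (ha : Summable fun j => |a j|) {h : ℝ → ℝ}
    (hh : IntegrableOn h (Ioc 0 1)) :
    HasSum (fun j => a j * ∫ t in Ioc (0 : ℝ) 1, t ^ j * h t)
      (∫ t in Ioc (0 : ℝ) 1, (∑' j, a j * t ^ j) * h t) := by
  have hle : ∀ j : ℕ, ∀ t ∈ Ioc (0 : ℝ) 1, ‖a j * t ^ j * h t‖ ≤ |a j| * ‖h t‖ := by
    intro j t ht
    rw [norm_mul, norm_mul, Real.norm_eq_abs (a j), norm_pow, Real.norm_of_nonneg ht.1.le]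
    gcongr
    exact mul_le_of_le_one_right (abs_nonneg _) (pow_le_one₀ ht.1.le ht.2)
  have hint : ∀ j, IntegrableOn (fun t => a j * t ^ j * h t) (Ioc 0 1) := by
    intro j
    refine (hh.norm.const_mul |a j|).mono' ?_ ?_
    · exact (by fun_prop : Continuous fun t : ℝ => a j * t ^ j).aestronglyMeasurable.mul hh.1
    · exact (ae_restrict_iff' measurableSet_Ioc).2 (Eventually.of_forall (hle j))
  have hsum : Summable fun j => ∫ t in Ioc (0 : ℝ) 1, ‖a j * t ^ j * h t‖ := by
    refine Summable.of_nonneg_of_le (fun j => by positivity) (fun j => ?_)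
      (ha.mul_right (∫ t in Ioc (0 : ℝ) 1, ‖h t‖))
    rw [← integral_const_mul]
    exact setIntegral_mono_on (hint j).norm (hh.norm.const_mul _) measurableSet_Ioc (hle j)
  have := hasSum_integral_of_summable_integral_norm hint hsum
  simp only [tsum_mul_right] at this
  simpa only [mul_assoc, integral_const_mul] using this

lemma integrableOn_rpow_sub_one {x : ℝ} (hx : 0 < x) :
    IntegrableOn (fun t : ℝ => t ^ (x - 1)) (Ioc 0 1) :=
  (intervalIntegrable_iff_integrableOn_Ioc_of_le zero_le_one).1
    (intervalIntegral.intervalIntegrable_rpow' (by linarith))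

lemma integral_tsum_mul_rpow {a : ℕ → ℝ} (ha : Summable fun j => |a j|) {x : ℝ} (hx : 0 < x) :
    ∫ t in Ioc (0 : ℝ) 1, (∑' j, a j * t ^ j) * t ^ (x - 1) = ∑' j : ℕ, a j / (x + j) := by
  rw [← (hasSum_integral_tsum_mul_pow ha (integrableOn_rpow_sub_one hx)).tsum_eq]
  refine tsum_congr fun j => ?_
  have hxj : 0 < x + j := by positivity
  have : ∫ t in Ioc (0 : ℝ) 1, t ^ j * t ^ (x - 1) = ∫ t in (0 : ℝ)..1, t ^ (x + j - 1) := by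
    rw [intervalIntegral.integral_of_le zero_le_one]
    refine setIntegral_congr_fun measurableSet_Ioc fun t ht => ?_
    rw [← Real.rpow_natCast, ← Real.rpow_add ht.1]
    congr 1
    ring
  rw [this, integral_rpow (Or.inl (by linarith)), Real.zero_rpow (by linarith), Real.one_rpow,
    sub_add_cancel, sub_zero, mul_one_div]

lemma integral_rpow_mul_one_sub_rpow {x p : ℝ} (hx : 0 < x) (hp : 0 < p) :
    ∫ t in Ioc (0 : ℝ) 1, (1 - t) ^ p * t ^ (x - 1) =
      Real.Gamma x * Real.Gamma (p + 1) / Real.Gamma (x + p + 1) := by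
  have h := Complex.betaIntegral_eq_Gamma_mul_div (x : ℂ) ((p + 1 : ℝ) : ℂ) (by simpa using hx)
    (by rw [Complex.ofReal_re]; linarith)
  rw [← Complex.ofReal_add, Complex.Gamma_ofReal, Complex.Gamma_ofReal, Complex.Gamma_ofReal,
    Complex.betaIntegral, intervalIntegral.integral_of_le zero_le_one] at h
  rw [add_assoc, ← Complex.ofReal_inj]
  push_cast at h ⊢
  rw [← h, ← integral_complex_ofReal]
  refine setIntegral_congr_fun measurableSet_Ioc fun t ht => ?_
  rw [Complex.ofReal_mul, Complex.ofReal_cpow ht.1.le, Complex.ofReal_cpow (by linarith [ht.2])]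
  push_cast
  rw [add_sub_cancel_right, mul_comm]

/-- The sum of partial fractions `∑ a_j / (x + j)` for the coefficients of `(1 - t) ^ p`; by the
convention for division by zero, a term with `x + j = 0` is left out. -/
def binomFrac (p x : ℝ) : ℝ := ∑' j : ℕ, binomCoeff p j / (x + j)

lemma binomFrac_of_pos {x p : ℝ} (hx : 0 < x) (hp : 0 < p) :
    binomFrac p x = Real.Gamma x * Real.Gamma (p + 1) / Real.Gamma (x + p + 1) := by
  rw [binomFrac, ← integral_tsum_mul_rpow (summable_abs_binomCoeff hp) hx,
    ← integral_rpow_mul_one_sub_rpow hx hp]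
  exact setIntegral_congr_fun measurableSet_Ioc fun t ht => by
    simp only [tsum_binomCoeff_mul_pow hp ⟨ht.1.le, ht.2⟩]

lemma summable_div_add_nat {a : ℕ → ℝ} (ha : Summable fun j => |a j|) (x : ℝ) :
    Summable fun j : ℕ => a j / (x + j) := by
  obtain ⟨M, hM⟩ := exists_nat_ge (1 - x)
  refine Summable.of_norm_bounded_eventually_nat ha ?_
  filter_upwards [eventually_ge_atTop M] with j hj
  have : (1 : ℝ) ≤ x + j := by
    have : (M : ℝ) ≤ j := by exact_mod_cast hj
    linarith
  rw [norm_div, Real.norm_eq_abs, Real.norm_of_nonneg (by linarith)]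
  exact div_le_self (abs_nonneg _) this

/-- The sum `∑ j a_j / (x + j)` is computed twice: from `j = (x + j) - x`, and, after shifting the
index, from `(j + 1) a_(j+1) = (j - p) a_j`. The conditional sums correct for an index with zero
denominator, where `(x + j) / (x + j)` is `0` instead of `1`. -/
lemma mul_binomFrac {p : ℝ} (hp : 0 < p) (x : ℝ) :
    x * binomFrac p x = (x + 1 + p) * binomFrac p (x + 1) +
      (∑' j : ℕ, if x + 1 + j = 0 then binomCoeff p j else 0) -
      ∑' j : ℕ, if x + j = 0 then binomCoeff p j else 0 := by
  have ha := summable_abs_binomCoeff hp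
  have hite : ∀ y : ℝ, Summable fun j : ℕ => if y + j = 0 then binomCoeff p j else 0 := by
    intro y
    refine ha.of_norm_bounded fun j => ?_
    split_ifs <;> simp
  have hS := ha.of_abs
  have h1 : ∀ j : ℕ, binomCoeff p j * j / (x + j) =
      binomCoeff p j - x * (binomCoeff p j / (x + j)) -
        if x + j = 0 then binomCoeff p j else 0 := by
    intro j
    split_ifs with h
    · simp [h]
    · field_simp; ring
  have h2 : ∀ j : ℕ, binomCoeff p (j + 1) * (j + 1 : ℕ) / (x + (j + 1 : ℕ)) =
      binomCoeff p j - (x + 1 + p) * (binomCoeff p j / (x + 1 + j)) -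
        if x + 1 + j = 0 then binomCoeff p j else 0 := by
    intro j
    rw [binomCoeff_succ]
    have : (j : ℝ) + 1 ≠ 0 := by positivity
    push_cast
    rw [div_mul_cancel₀ _ this, show x + ((j : ℝ) + 1) = x + 1 + j by ring]
    split_ifs with h
    · simp [h]
    · field_simp; ring
  have s1 := (summable_div_add_nat ha x).mul_left x
  have s2 := (summable_div_add_nat ha (x + 1)).mul_left (x + 1 + p)
  have hs : Summable fun j : ℕ => binomCoeff p j * j / (x + j) :=
    ((hS.sub s1).sub (hite x)).congr fun j => (h1 j).symm
  have e1 : ∑' j : ℕ, binomCoeff p j * j / (x + j) = (∑' j, binomCoeff p j) - x * binomFrac p x -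
      ∑' j : ℕ, if x + j = 0 then binomCoeff p j else 0 := by
    rw [tsum_congr h1, (hS.sub s1).tsum_sub (hite x), hS.tsum_sub s1, tsum_mul_left, binomFrac]
  have e2 : ∑' j : ℕ, binomCoeff p j * j / (x + j) =
      (∑' j, binomCoeff p j) - (x + 1 + p) * binomFrac p (x + 1) -
      ∑' j : ℕ, if x + 1 + j = 0 then binomCoeff p j else 0 := by
    rw [hs.tsum_eq_zero_add, tsum_congr h2, (hS.sub s2).tsum_sub (hite _), hS.tsum_sub s2,
      tsum_mul_left, binomFrac]
    simp
  linarith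

lemma binomFrac_sub_one {p : ℝ} (hp : 0 < p) {x : ℝ} (hx : ∀ j : ℕ, x - 1 + j ≠ 0) :
    binomFrac p (x - 1) = (x + p) / (x - 1) * binomFrac p x := by
  have h := mul_binomFrac hp (x - 1)
  have hx' : ∀ j : ℕ, x + j ≠ 0 := fun j h => hx (j + 1) (by push_cast; linarith)
  have hx0 : x - 1 ≠ 0 := by simpa using hx 0
  simp only [sub_add_cancel, hx, hx', if_false, tsum_zero, add_zero, sub_zero] at h
  field_simp
  linarith

lemma tsum_ite_neg_nat_add_eq_zero (a : ℕ → ℝ) (n : ℕ) :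
    (∑' j : ℕ, if -(n : ℝ) + j = 0 then a j else 0) = a n := by
  have : ∀ j : ℕ, (-(n : ℝ) + j = 0) ↔ j = n := fun j => by
    rw [neg_add_eq_zero, Nat.cast_inj, eq_comm]
  simp [this]

lemma binomFrac_neg_nat_succ {p : ℝ} (hp : 0 < p) (n : ℕ) :
    binomFrac p (-((n + 1 : ℕ) : ℝ)) = (n - p) / (n + 1) * binomFrac p (-(n : ℝ)) +
      (binomCoeff p (n + 1) - binomCoeff p n) / (n + 1) := by
  have h := mul_binomFrac hp (-((n + 1 : ℕ) : ℝ))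
  have e : -((n + 1 : ℕ) : ℝ) + 1 = -(n : ℝ) := by push_cast; ring
  rw [e, tsum_ite_neg_nat_add_eq_zero, tsum_ite_neg_nat_add_eq_zero] at h
  have : (n : ℝ) + 1 ≠ 0 := by positivity
  field_simp
  push_cast at h ⊢
  linarith

/-- Only the `j = 0` term is singular at `0`. In the limit that term reads `a 0 / 0 = 0`, so the sum
on the right is the finite part. -/
lemma tendsto_tsum_div_add_nat {a : ℕ → ℝ} (ha : Summable fun j => |a j|) :
    Tendsto (fun x : ℝ => (∑' j : ℕ, a j / (x + j)) - a 0 / x) (𝓝[>] 0)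
      (𝓝 (∑' j : ℕ, a j / (0 + j : ℝ))) := by
  have ha' : Summable fun j => |a (j + 1)| := (summable_nat_add_iff 1).2 ha
  have h : Tendsto (fun x : ℝ => ∑' j : ℕ, a (j + 1) / (x + (j + 1 : ℕ))) (𝓝[>] 0)
      (𝓝 (∑' j : ℕ, a (j + 1) / (0 + (j + 1 : ℕ) : ℝ))) := by
    refine tendsto_tsum_of_dominated_convergence ha' (fun j => ?_) ?_
    · refine Tendsto.mono_left ?_ nhdsWithin_le_nhds
      have : ContinuousAt (fun x : ℝ => a (j + 1) / (x + (j + 1 : ℕ))) 0 :=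
        continuousAt_const.div (by fun_prop) (by push_cast; positivity)
      exact this
    · filter_upwards [self_mem_nhdsWithin] with x hx j
      have hx0 : (0 : ℝ) < x := hx
      have : (1 : ℝ) ≤ x + (j + 1 : ℕ) := by
        push_cast
        have : (0 : ℝ) ≤ j := by positivity
        linarith
      rw [norm_div, Real.norm_eq_abs, Real.norm_of_nonneg (by linarith)]
      exact div_le_self (abs_nonneg _) this
  rw [(summable_div_add_nat ha 0).tsum_eq_zero_add]
  simp only [Nat.cast_zero, add_zero, div_zero, zero_add] at h ⊢
  refine h.congr' (Eventually.of_forall fun x => ?_)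
  beta_reduce
  rw [(summable_div_add_nat ha x).tsum_eq_zero_add]
  simp

/-- As `Γ(x) = Γ(x + 1) / x`, the expression is the difference quotient at `0` of `Γ(x + 1) f(x)`.
It serves for the finite part of the Beta function and for the exponential integral of order one. -/
lemma tendsto_Gamma_mul_sub_inv {f : ℝ → ℝ} {f' : ℝ} (hf : HasDerivAt f f' 0) (hf0 : f 0 = 1) :
    Tendsto (fun x : ℝ => Real.Gamma x * f x - 1 / x) (𝓝[>] 0) (𝓝 (psi 1 + f')) := by
  have h1 : HasDerivAt (fun x : ℝ => Real.Gamma (x + 1)) (psi 1 * Real.Gamma 1) 0 := by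
    have := hasDerivAt_Gamma one_pos
    rw [← zero_add (1 : ℝ)] at this
    simpa using this.comp_add_const 0 1
  have h2 := h1.mul hf
  rw [hasDerivAt_iff_tendsto_slope] at h2
  have h3 := h2.mono_left (nhdsWithin_mono 0 (fun x (hx : 0 < x) => hx.ne'))
  simp only [zero_add, Real.Gamma_one, hf0, mul_one, one_mul] at h3
  refine h3.congr' ?_
  filter_upwards [self_mem_nhdsWithin] with x hx
  have hx0 : x ≠ 0 := ne_of_gt hx
  simp only [slope_def_field, Pi.mul_apply, zero_add, Real.Gamma_one, hf0,
    Real.Gamma_add_one hx0, sub_zero]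
  field_simp

lemma binomFrac_zero {p : ℝ} (hp : 0 < p) : binomFrac p 0 = psi 1 - psi (p + 1) := by
  have h1 := tendsto_tsum_div_add_nat (summable_abs_binomCoeff hp)
  have hG : Real.Gamma (p + 1) ≠ 0 := (Real.Gamma_pos_of_pos (by linarith)).ne'
  have hf : HasDerivAt (fun x : ℝ => Real.Gamma (p + 1) / Real.Gamma (x + (p + 1)))
      (-psi (p + 1)) 0 := by
    have h0 : HasDerivAt (fun x : ℝ => Real.Gamma (x + (p + 1)))
        (psi (p + 1) * Real.Gamma (p + 1)) 0 := by
      have := hasDerivAt_Gamma (x := 0 + (p + 1)) (by linarith)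
      simpa only [zero_add] using this.comp_add_const 0 (p + 1)
    refine ((hasDerivAt_const (0 : ℝ) (Real.Gamma (p + 1))).div h0
      (by simpa using hG)).congr_deriv ?_
    rw [zero_add (p + 1)]
    field_simp
    ring
  have h2 := tendsto_Gamma_mul_sub_inv hf (by simp [hG])
  refine tendsto_nhds_unique (h1.congr' ?_) h2
  filter_upwards [self_mem_nhdsWithin] with x hx
  rw [← binomFrac, binomFrac_of_pos hx hp, binomCoeff_zero, mul_div_assoc, add_assoc]

/-! ### Generalized exponential integrals -/

lemma integrableOn_exp_neg_mul_div_pow {c : ℝ} (hc : 0 < c) (m : ℕ) :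
    IntegrableOn (fun u : ℝ => Real.exp (-c * u) / u ^ m) (Ioi 1) := by
  refine (exp_neg_integrableOn_Ioi 1 hc).mono'
    (by fun_prop : Measurable fun u : ℝ => Real.exp (-c * u) / u ^ m).aestronglyMeasurable ?_
  refine (ae_restrict_iff' measurableSet_Ioi).2 (Eventually.of_forall fun u hu => ?_)
  have hu1 : (1 : ℝ) < u := hu
  rw [norm_div, Real.norm_of_nonneg (Real.exp_pos _).le, Real.norm_of_nonneg (by positivity)]
  exact div_le_self (Real.exp_pos _).le (one_le_pow₀ hu1.le)

/-- The generalized exponential integral of order `m + 1`. -/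
def expInt (m : ℕ) (c : ℝ) : ℝ := ∫ u in Ioi (1 : ℝ), Real.exp (-c * u) / u ^ (m + 1)

/-- Integration by parts. -/
lemma expInt_succ {c : ℝ} (hc : 0 < c) (m : ℕ) :
    (m + 1) * expInt (m + 1) c = Real.exp (-c) - c * expInt m c := by
  have hderiv : ∀ u ∈ Ici (1 : ℝ), HasDerivAt (fun u : ℝ => -(Real.exp (-c * u) / u ^ (m + 1)))
      ((m + 1) * (Real.exp (-c * u) / u ^ (m + 1 + 1)) + c * (Real.exp (-c * u) / u ^ (m + 1)))
      u := by
    intro u hu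
    have hu0 : u ≠ 0 := by
      have : (1 : ℝ) ≤ u := hu
      positivity
    have h1 : HasDerivAt (fun u : ℝ => Real.exp (-c * u)) (Real.exp (-c * u) * (-c)) u := by
      simpa using ((hasDerivAt_id u).const_mul (-c)).exp
    refine ((h1.div (hasDerivAt_pow (m + 1) u) (pow_ne_zero _ hu0)).neg).congr_deriv ?_
    simp only [Nat.add_sub_cancel]
    push_cast
    field_simp
    ring
  have hlim : Tendsto (fun u : ℝ => -(Real.exp (-c * u) / u ^ (m + 1))) atTop (𝓝 0) := by
    have h1 : Tendsto (fun u : ℝ => Real.exp (-c * u)) atTop (𝓝 0) :=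
      Real.tendsto_exp_atBot.comp (tendsto_id.const_mul_atTop_of_neg (by linarith))
    have h2 : Tendsto (fun u : ℝ => u ^ (m + 1)) atTop atTop := tendsto_pow_atTop (by omega)
    simpa using (h1.div_atTop h2).neg
  have i1 := (integrableOn_exp_neg_mul_div_pow hc (m + 1 + 1)).const_mul ((m : ℝ) + 1)
  have i2 := (integrableOn_exp_neg_mul_div_pow hc (m + 1)).const_mul c
  have h := integral_Ioi_of_hasDerivAt_of_tendsto' hderiv (i1.add i2) hlim
  rw [integral_add i1 i2, integral_const_mul, integral_const_mul] at h
  rw [expInt, expInt]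
  simp only [mul_one, one_pow, div_one] at h
  linarith

/-- The coefficients of `exp (-c t)`. -/
def expCoeff (c : ℝ) (k : ℕ) : ℝ := (-c) ^ k / (k.factorial : ℝ)

lemma expCoeff_succ (c : ℝ) (k : ℕ) : (k + 1) * expCoeff c (k + 1) = -c * expCoeff c k := by
  simp only [expCoeff, Nat.factorial_succ]
  push_cast
  field_simp
  ring

lemma summable_abs_expCoeff (c : ℝ) : Summable fun k => |expCoeff c k| :=
  (Real.summable_pow_div_factorial (-c)).abs

lemma hasSum_expCoeff (c : ℝ) : HasSum (expCoeff c) (Real.exp (-c)) := by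
  have := NormedSpace.expSeries_div_hasSum_exp (-c)
  rwa [← Real.exp_eq_exp_ℝ] at this

lemma tsum_expCoeff_mul_pow (c t : ℝ) : ∑' k, expCoeff c k * t ^ k = Real.exp (-c * t) := by
  have := (hasSum_expCoeff (c * t)).tsum_eq
  rw [← neg_mul] at this
  rw [← this]
  refine tsum_congr fun k => ?_
  rw [expCoeff, expCoeff, ← neg_mul, mul_pow]
  ring

lemma integral_Ioi_rpow_mul_exp {c s : ℝ} (hc : 0 < c) (hs : 0 < s) :
    ∫ u in Ioi (1 : ℝ), u ^ (s - 1) * Real.exp (-c * u) =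
      Real.Gamma s * (1 / c) ^ s - ∑' k : ℕ, expCoeff c k / (s + k) := by
  have h1 : ∫ u in Ioi (0 : ℝ), u ^ (s - 1) * Real.exp (-c * u) = (1 / c) ^ s * Real.Gamma s := by
    simpa only [neg_mul] using Real.integral_rpow_mul_exp_neg_mul_Ioi hs hc
  have hint : IntegrableOn (fun u : ℝ => u ^ (s - 1) * Real.exp (-c * u)) (Ioi 0) := by
    -- A non-integrable function has Bochner integral `0`, whereas the value in `h1` is positive.
    by_contra h
    rw [integral_undef h] at h1
    have := Real.Gamma_pos_of_pos hs
    exact absurd h1.symm (by positivity)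
  have h2 := integral_tsum_mul_rpow (summable_abs_expCoeff c) hs
  simp only [tsum_expCoeff_mul_pow] at h2
  rw [← h2, mul_comm (Real.Gamma s), ← h1, ← Ioc_union_Ioi_eq_Ioi (zero_le_one' ℝ),
    setIntegral_union (Ioc_disjoint_Ioi le_rfl) measurableSet_Ioi
      (hint.mono_set Ioc_subset_Ioi_self) (hint.mono_set (Ioi_subset_Ioi zero_le_one))]
  simp only [mul_comm (Real.exp _)]
  ring

/-- Limit `s → 0+` of the incomplete Gamma identity `integral_Ioi_rpow_mul_exp`: the pole of `Γ(s)
c^(-s)` cancels against the `k = 0` term `1 / s`. -/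
lemma expInt_zero {c : ℝ} (hc : 0 < c) :
    expInt 0 c = psi 1 - Real.log c - ∑' k : ℕ, expCoeff c k / (k : ℝ) := by
  have h1 := tendsto_tsum_div_add_nat (summable_abs_expCoeff c)
  have hf : HasDerivAt (fun s : ℝ => (1 / c) ^ s) (-Real.log c) 0 := by
    have := (hasDerivAt_id (0 : ℝ)).const_rpow (a := 1 / c) (by positivity)
    simpa using this
  have h2 := tendsto_Gamma_mul_sub_inv hf (by simp)
  have h3 : Tendsto (fun s : ℝ => ∫ u in Ioi (1 : ℝ), u ^ (s - 1) * Real.exp (-c * u)) (𝓝[>] 0)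
      (𝓝 (expInt 0 c)) := by
    refine tendsto_integral_filter_of_dominated_convergence (fun u => Real.exp (-c * u))
      (Eventually.of_forall fun s => by fun_prop) ?_ (exp_neg_integrableOn_Ioi 1 hc) ?_
    · have : ∀ᶠ s : ℝ in 𝓝[>] 0, s < 1 := nhdsWithin_le_nhds (gt_mem_nhds one_pos)
      filter_upwards [this] with s hs
      refine (ae_restrict_iff' measurableSet_Ioi).2 (Eventually.of_forall fun u hu => ?_)
      have hu1 : (1 : ℝ) < u := hu
      rw [norm_mul, Real.norm_of_nonneg (Real.exp_pos _).le, Real.norm_of_nonneg (by positivity)]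
      exact mul_le_of_le_one_left (Real.exp_pos _).le
        (Real.rpow_le_one_of_one_le_of_nonpos hu1.le (by linarith))
    · refine (ae_restrict_iff' measurableSet_Ioi).2 (Eventually.of_forall fun u hu => ?_)
      have hu1 : (1 : ℝ) < u := hu
      refine Tendsto.mono_left ?_ nhdsWithin_le_nhds
      have : ContinuousAt (fun s : ℝ => u ^ (s - 1) * Real.exp (-c * u)) 0 :=
        (continuousAt_const.rpow (by fun_prop) (Or.inl (by positivity))).mul continuousAt_const
      convert this.tendsto using 2
      rw [zero_sub, Real.rpow_neg_one, zero_add, pow_one, div_eq_inv_mul]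
  have h4 := tendsto_nhds_unique h3 ((h2.sub h1).congr' ?_)
  · simpa [sub_eq_add_neg] using h4
  · filter_upwards [self_mem_nhdsWithin] with s hs
    rw [integral_Ioi_rpow_mul_exp hc hs]
    simp [expCoeff]

/-- The series counterpart of `expInt_succ`, again by evaluating `∑ k e_k / (k - m - 1)` in two
ways. The extra `expCoeff c (m + 1)` comes from the omitted term `k = m + 1`. -/
lemma mul_tsum_expCoeff_div (c : ℝ) (m : ℕ) :
    (m + 1) * ∑' k : ℕ, expCoeff c k / (k - (m + 1 : ℕ) : ℝ) +
      c * ∑' k : ℕ, expCoeff c k / (k - m : ℝ) = expCoeff c (m + 1) - Real.exp (-c) := by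
  have hs : ∀ m : ℕ, Summable fun k : ℕ => expCoeff c k / (k - m : ℝ) := fun m => by
    simpa [sub_eq_neg_add] using summable_div_add_nat (summable_abs_expCoeff c) (-(m : ℝ))
  have hE := hasSum_expCoeff c
  have h1 : ∀ k : ℕ, c * (expCoeff c k / (k - m : ℝ)) =
      -(expCoeff c (k + 1) * (k + 1 : ℕ) / ((k + 1 : ℕ) - (m + 1 : ℕ) : ℝ)) := by
    intro k
    have := expCoeff_succ c k
    push_cast
    rw [mul_comm (expCoeff c (k + 1)), this, add_sub_add_right_eq_sub]
    ring
  have h2 : ∀ k : ℕ, expCoeff c k * k / (k - (m + 1 : ℕ) : ℝ) = expCoeff c k -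
      (if k = m + 1 then expCoeff c k else 0) +
      (m + 1) * (expCoeff c k / (k - (m + 1 : ℕ) : ℝ)) := by
    intro k
    split_ifs with h
    · simp [h]
    · have : (k : ℝ) - (m + 1 : ℕ) ≠ 0 := by
        rw [sub_ne_zero]
        exact_mod_cast h
      push_cast at this ⊢
      field_simp
      ring
  have hite : HasSum (fun k => if k = m + 1 then expCoeff c k else 0) (expCoeff c (m + 1)) := by
    have := hasSum_ite_eq (m + 1) (expCoeff c (m + 1))
    refine this.congr_fun fun k => ?_
    split_ifs with h <;> simp [h]
  have h3 := (hE.sub hite).add ((hs (m + 1)).hasSum.mul_left ((m : ℝ) + 1))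
  have h4 := h3.congr_fun h2
  have h5 : ∑' k : ℕ, expCoeff c k * k / (k - (m + 1 : ℕ) : ℝ) =
      -(c * ∑' k : ℕ, expCoeff c k / (k - m : ℝ)) := by
    rw [h4.summable.tsum_eq_zero_add, ← tsum_mul_left, tsum_congr h1, tsum_neg]
    simp
  rw [h4.tsum_eq] at h5
  linarith

lemma expInt_eq {c : ℝ} (hc : 0 < c) (m : ℕ) :
    expInt m c = expCoeff c m * (psi (m + 1) - Real.log c) -
      ∑' k : ℕ, expCoeff c k / (k - m : ℝ) := by
  induction m with
  | zero => simp [expInt_zero hc, expCoeff]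
  | succ m ih =>
    have h1 := expInt_succ hc m
    have h2 := mul_tsum_expCoeff_div c m
    have h3 := expCoeff_succ c m
    have h4 := psi_add_one_of_pos (x := m + 1) (by positivity)
    have hm : (m : ℝ) + 1 ≠ 0 := by positivity
    rw [ih] at h1
    push_cast at h1 h2 ⊢
    rw [h4]
    apply mul_left_cancel₀ hm
    rw [h1]
    have h5 : ((m : ℝ) + 1) * (1 / (m + 1)) = 1 := by field_simp
    linear_combination h2 - (psi (m + 1) - Real.log c) * h3 - expCoeff c (m + 1) * h5

lemma integral_pow_mul_exp_neg_rpow (c : ℝ) (n : ℕ) :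
    ∫ t in Ioc (0 : ℝ) 1, t ^ n * Real.exp (-c * t ^ (-(1 / 2) : ℝ)) =
      2 * expInt (2 * n + 2) c := by
  -- Substitution `t = u⁻²`; the indicator is needed because the change of variables is stated on
  -- all of `(0, ∞)`.
  have h := integral_comp_rpow_Ioi
    ((Ioc (0 : ℝ) 1).indicator fun t => t ^ n * Real.exp (-c * t ^ (-(1 / 2) : ℝ)))
    (p := -2) (by norm_num)
  rw [setIntegral_indicator measurableSet_Ioc,
    inter_eq_right.2 (Ioc_subset_Ioi_self : Ioc (0 : ℝ) 1 ⊆ Ioi 0)] at h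
  have hsub : Ioi (0 : ℝ) ∩ Ici 1 = Ici 1 := inter_eq_right.2 (Ici_subset_Ioi.2 one_pos)
  rw [← h, expInt, ← integral_const_mul, ← integral_Ici_eq_integral_Ioi (x := (1 : ℝ)), ← hsub,
    ← setIntegral_indicator measurableSet_Ici]
  refine setIntegral_congr_fun measurableSet_Ioi fun u hu => ?_
  have hu0 : (0 : ℝ) < u := hu
  have hpow : u ^ (-2 : ℝ) = (u ^ 2)⁻¹ := by
    rw [Real.rpow_neg hu0.le, Real.rpow_ofNat]
  by_cases hu1 : 1 ≤ u
  · have hmem : u ^ (-2 : ℝ) ∈ Ioc (0 : ℝ) 1 :=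
      ⟨by positivity, Real.rpow_le_one_of_one_le_of_nonpos hu1 (by norm_num)⟩
    rw [indicator_of_mem (show u ∈ Ici (1 : ℝ) from hu1), indicator_of_mem hmem,
      ← Real.rpow_mul hu0.le, hpow, show (-2 : ℝ) - 1 = -3 by norm_num, Real.rpow_neg hu0.le,
      Real.rpow_ofNat, show (-2 : ℝ) * -(1 / 2) = 1 by norm_num, Real.rpow_one]
    norm_num
    field_simp
    ring
  · have hmem : u ^ (-2 : ℝ) ∉ Ioc (0 : ℝ) 1 := fun hh => hu1 <| by
      have h2 := hh.2
      rw [hpow, inv_le_one₀ (by positivity)] at h2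
      nlinarith
    rw [indicator_of_notMem (show u ∉ Ici (1 : ℝ) from hu1), indicator_of_notMem hmem, smul_zero]

/-! ### Partial fraction sums at nonpositive integers -/

/-- The condition on `q` keeps `ψ(q + 1 - n)` and the earlier values in the recurrence away from the
poles of `ψ`. -/
lemma binomFrac_neg_nat {q : ℝ} (hq : 0 < q) (n : ℕ) (hqn : ∀ i < n, q ≠ (i : ℝ)) :
    binomFrac q (-(n : ℝ)) = binomCoeff q n * (psi (1 + n) - psi (q + 1 - n)) := by
  induction n with
  | zero => simp [binomFrac_zero hq, binomCoeff_zero]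
  | succ n ih =>
    have hn : q - n ≠ 0 := sub_ne_zero.2 (hqn n (by omega))
    have h1 := psi_add_one (x := q - n) fun m h => hn <| by
      have h2 : q = ((n - m : ℤ) : ℝ) := by push_cast; linarith
      have h3 : (0 : ℝ) < ((n - m : ℤ) : ℝ) := by rw [← h2]; exact hq
      have h4 : (0 : ℤ) < n - m := by exact_mod_cast h3
      rcases Nat.eq_zero_or_pos m with rfl | hm
      · rw [h]; simp
      · refine absurd ?_ (hqn (n - m) (by omega))
        rw [h2]
        push_cast [Nat.cast_sub (by omega : m ≤ n)]
        ring
    have h2 := psi_add_one_of_pos (x := 1 + n) (by positivity)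
    rw [binomFrac_neg_nat_succ hq, ih fun i hi => hqn i (by omega), binomCoeff_succ]
    rw [show q + 1 - ((n + 1 : ℕ) : ℝ) = q - n by push_cast; ring,
      show (1 : ℝ) + ((n + 1 : ℕ) : ℝ) = 1 + n + 1 by push_cast; ring,
      show q + 1 - (n : ℝ) = q - n + 1 by ring, h1, h2]
    have h3 : (n : ℝ) + 1 ≠ 0 := by positivity
    have h4 : (1 : ℝ) + n ≠ 0 := by positivity
    field_simp
    ring

lemma binomCoeff_natCast_of_lt {N n : ℕ} (h : N < n) : binomCoeff N n = 0 := by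
  induction n, h using Nat.le_induction with
  | base => simp [binomCoeff_succ]
  | succ n _ ih => simp [binomCoeff_succ, ih]

lemma binomCoeff_natCast_self (N : ℕ) : binomCoeff N N = (-1) ^ N := by
  have h : ∀ j : ℕ, j ≤ N → poch (-(N : ℝ)) j * ((N - j).factorial : ℝ) =
      (-1) ^ j * (N.factorial : ℝ) := by
    intro j
    induction j with
    | zero => simp [poch_zero]
    | succ j ih =>
      intro hj
      have h1 := ih (by omega)
      rw [show N - j = N - (j + 1) + 1 by omega, Nat.factorial_succ] at h1
      push_cast [Nat.cast_sub hj] at h1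
      rw [poch_succ, pow_succ]
      linear_combination (-1 : ℝ) * h1
  have h0 : (N.factorial : ℝ) ≠ 0 := by positivity
  have := h N le_rfl
  simp only [Nat.sub_self, Nat.factorial_zero, Nat.cast_one, mul_one] at this
  rw [binomCoeff, this, mul_div_assoc, div_self h0, mul_one]

/-- At index `N` the homogeneous part of the recurrence has factor `N - N = 0`, so only `-a_N / (N +
1)` survives; beyond it all coefficients vanish and the recurrence is a pure product. -/
lemma binomFrac_natCast_neg_nat {N : ℕ} (hN : 0 < N) (m : ℕ) :
    binomFrac N (-((N + 1 + m : ℕ) : ℝ)) =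
      (-1) ^ (N + 1) * (m.factorial : ℝ) * (N.factorial : ℝ) / ((N + 1 + m).factorial : ℝ) := by
  have hN' : (0 : ℝ) < N := by exact_mod_cast hN
  induction m with
  | zero =>
    rw [add_zero, binomFrac_neg_nat_succ hN', binomCoeff_natCast_of_lt (Nat.lt_succ_self N),
      binomCoeff_natCast_self, Nat.factorial_succ N]
    have h0 : (N.factorial : ℝ) ≠ 0 := by positivity
    push_cast
    field_simp
    simp [pow_succ]
  | succ m ih =>
    rw [← add_assoc, binomFrac_neg_nat_succ hN', ih, binomCoeff_natCast_of_lt (by omega),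
      binomCoeff_natCast_of_lt (by omega), Nat.factorial_succ m, Nat.factorial_succ (N + 1 + m)]
    push_cast
    field_simp
    ring

lemma continuous_poch (r : ℕ) : Continuous fun a => poch a r := by
  simp only [poch]
  exact (ascPochhammer ℝ r).continuous

lemma continuous_binomCoeff (r : ℕ) : Continuous fun q => binomCoeff q r :=
  ((continuous_poch r).comp continuous_neg).div_const _

/-- The recurrence in `n` never divides by an expression in `q`, so continuity persists at the
integers where the digamma formula degenerates. -/
lemma continuousAt_binomFrac_neg_nat {q : ℝ} (hq : 0 < q) (n : ℕ) :
    ContinuousAt (fun q => binomFrac q (-(n : ℝ))) q := by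
  have hev : ∀ᶠ x : ℝ in 𝓝 q, 0 < x := lt_mem_nhds hq
  induction n with
  | zero =>
    have h : ContinuousAt (fun q => psi 1 - psi (q + 1)) q :=
      continuousAt_const.sub
        ((continuousAt_psi (by linarith : 0 < q + 1)).comp_of_eq (by fun_prop) rfl)
    refine h.congr ?_
    filter_upwards [hev] with x hx
    simp [binomFrac_zero hx]
  | succ n ih =>
    have h : ContinuousAt (fun q => ((n : ℝ) - q) / (n + 1) * binomFrac q (-(n : ℝ)) +
        (binomCoeff q (n + 1) - binomCoeff q n) / (n + 1)) q :=
      (ContinuousAt.mul (by fun_prop) ih).add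
        (((continuous_binomCoeff _).sub (continuous_binomCoeff _)).div_const _).continuousAt
    refine h.congr ?_
    filter_upwards [hev] with x hx
    rw [binomFrac_neg_nat_succ hx]

/-! ### Gamma function and exponential coefficients in terms of Pochhammer symbols -/

lemma poch_pos {a : ℝ} (ha : 0 < a) (r : ℕ) : 0 < poch a r := ascPochhammer_pos r a ha

lemma poch_add (a : ℝ) (m r : ℕ) : poch a (m + r) = poch a m * poch (a + m) r := by
  induction r with
  | zero => simp [poch_zero]
  | succ r ih => rw [← add_assoc, poch_succ, ih, poch_succ]; push_cast; ring

lemma Gamma_half_sub_nat (n : ℕ) :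
    Real.Gamma (1 / 2 - n) = (-1) ^ n * Real.sqrt Real.pi / poch (1 / 2) n := by
  induction n with
  | zero => rw [Nat.cast_zero, sub_zero, Real.Gamma_one_half_eq, poch_zero]; simp
  | succ n ih =>
    have h0 := (poch_pos one_half_pos n).ne'
    have h1 : (1 : ℝ) / 2 + n ≠ 0 := by positivity
    have h2 : (1 : ℝ) / 2 - (n + 1 : ℕ) = -(1 / 2 + n) := by push_cast; ring
    have h := Real.Gamma_add_one (s := (1 : ℝ) / 2 - (n + 1 : ℕ)) (by rw [h2]; exact neg_ne_zero.2 h1)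
    rw [show (1 : ℝ) / 2 - (n + 1 : ℕ) + 1 = 1 / 2 - n by push_cast; ring, ih] at h
    rw [poch_succ, pow_succ, eq_div_iff (mul_ne_zero h0 h1)]
    rw [div_eq_iff h0, h2] at h
    rw [h2]
    linear_combination h

lemma expCoeff_two_mul {z : ℝ} (hz : 0 ≤ z) (r : ℕ) :
    expCoeff (2 * Real.sqrt z) (2 * r) = z ^ r / (poch (1 / 2) r * (r.factorial : ℝ)) := by
  induction r with
  | zero => simp [expCoeff, poch_zero]
  | succ r ih =>
    have h1 := expCoeff_succ (2 * Real.sqrt z) (2 * r)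
    have h2 := expCoeff_succ (2 * Real.sqrt z) (2 * r + 1)
    have h0 := (poch_pos one_half_pos r).ne'
    have hf : (r.factorial : ℝ) ≠ 0 := by positivity
    have hs := Real.mul_self_sqrt hz
    rw [show 2 * (r + 1) = 2 * r + 1 + 1 by ring, poch_succ, Nat.factorial_succ]
    have h3 : (1 : ℝ) / 2 + r ≠ 0 := by positivity
    have h5 : (r : ℝ) + 1 ≠ 0 := by positivity
    rw [ih] at h1
    push_cast at h1 h2 ⊢
    rw [eq_div_iff (by positivity)]
    have h4 : z ^ r / (poch (1 / 2) r * (r.factorial : ℝ)) * (poch (1 / 2) r * r.factorial) = z ^ r :=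
      div_mul_cancel₀ _ (by positivity)
    rw [pow_succ, ← h4]
    set P := poch (1 / 2) r * (r.factorial : ℝ)
    linear_combination (P * (1 / 2 + r) / 2) * h2 - (P * Real.sqrt z / 2) * h1 +
      (z ^ r / P * P) * hs

lemma expCoeff_two_mul_add_one {z : ℝ} (hz : 0 ≤ z) (r : ℕ) :
    expCoeff (2 * Real.sqrt z) (2 * r + 1) =
      -(2 * Real.sqrt z * (z ^ r / (poch (3 / 2) r * (r.factorial : ℝ)))) := by
  have h1 := expCoeff_succ (2 * Real.sqrt z) (2 * r)
  rw [expCoeff_two_mul hz] at h1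
  have h2 := poch_add (1 / 2) 1 r
  rw [add_comm 1 r, poch_succ, poch_succ, poch_zero] at h2
  norm_num at h2
  have h0 := poch_pos one_half_pos r
  have h3 := poch_pos (show (0 : ℝ) < 3 / 2 by norm_num) r
  have hf : (0 : ℝ) < r.factorial := by positivity
  have h4 : (2 * (r : ℝ) + 1) * poch (1 / 2) r = poch (3 / 2) r := by linarith
  have h5 : (2 * (r : ℝ) + 1) ≠ 0 := by positivity
  rw [← h4]
  push_cast at h1
  apply mul_left_cancel₀ h5
  rw [h1]
  field_simp

/-! ### The three parts of the expansion -/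

/-- Analytic continuation of the Beta function leftwards by unit steps; the hypothesis ensures that
no step lands on a pole. -/
lemma binomFrac_sub_nat {p : ℝ} (hp : 0 < p) {x : ℝ} (r : ℕ)
    (hx : ∀ i < r, ∀ j : ℕ, x - (i + 1) + j ≠ 0) :
    binomFrac p (x - r) = binomFrac p x * (poch (-x - p) r / poch (1 - x) r) := by
  induction r with
  | zero => simp [poch_zero]
  | succ r ih =>
    have h1 := binomFrac_sub_one hp (x := x - r) fun j => by
      rw [sub_sub]; exact hx r (by omega) j
    have h2 : x - (r : ℝ) - 1 ≠ 0 := by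
      have := hx r (by omega) 0
      rwa [Nat.cast_zero, add_zero, ← sub_sub] at this
    rw [show x - ((r + 1 : ℕ) : ℝ) = x - r - 1 by push_cast; ring, h1,
      ih fun i hi => hx i (by omega), poch_succ, poch_succ, mul_div_mul_comm]
    have h3 : (x - r + p) / (x - r - 1) = (-x - p + r) / (1 - x + r) := by
      rw [← neg_div_neg_eq]
      congr 1 <;> ring
    rw [h3]
    ring

/-- The `r`-th term of the logarithmic series, in a form which is continuous in `q = 1 / (1 - α)`. -/
def logForm (ν : ℕ) (z q : ℝ) (r : ℕ) : ℝ :=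
  Real.sqrt Real.pi / (Real.Gamma (q + 1) * z ^ (1 + ν)) *
    (expCoeff (2 * Real.sqrt z) (2 * (ν + r) + 2) *
      (binomCoeff q r * (psi (1 / 2 + (ν + r + 1 : ℕ)) + psi (1 + (ν + r + 1 : ℕ)) - Real.log z) +
        binomFrac q (-(r : ℝ))))

lemma logForm_eq {ν : ℕ} {z q : ℝ} (hz : 0 < z) (hq : 0 < q) (r : ℕ) :
    logForm ν z q r = z ^ r * ((-1) ^ (1 + ν) * Real.Gamma (-(1 / 2) - (ν : ℝ)) /
      (poch (3 / 2 + (ν : ℝ)) r * ((1 + ν + r).factorial : ℝ) * Real.Gamma (q + 1)) *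
      (binomCoeff q r * (psi (1 / 2 + (ν + r + 1 : ℕ)) + psi (1 + (ν + r + 1 : ℕ)) - Real.log z) +
        binomFrac q (-(r : ℝ)))) := by
  have hG := (Real.Gamma_pos_of_pos (show 0 < q + 1 by linarith)).ne'
  have h1 : -(1 / 2) - (ν : ℝ) = 1 / 2 - (1 + ν : ℕ) := by push_cast; ring
  have h2 := poch_add (1 / 2) (1 + ν) r
  rw [show (1 : ℝ) / 2 + (1 + ν : ℕ) = 3 / 2 + ν by push_cast; ring] at h2
  have h3 := (poch_pos one_half_pos (1 + ν)).ne'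
  have h4 := (poch_pos (show (0 : ℝ) < 3 / 2 + ν by positivity) r).ne'
  have h5 : ((-1 : ℝ) ^ (1 + ν)) * (-1) ^ (1 + ν) = 1 := by rw [← mul_pow]; simp
  have h6 : (-1) ^ (1 + ν) * Real.Gamma (-(1 / 2) - (ν : ℝ)) =
      Real.sqrt Real.pi / poch (1 / 2) (1 + ν) := by
    rw [h1, Gamma_half_sub_nat, ← mul_div_assoc, ← mul_assoc, h5, one_mul]
  rw [logForm, show 2 * (ν + r) + 2 = 2 * (1 + ν + r) by ring, expCoeff_two_mul hz.le, h6,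
    h2, pow_add z (1 + ν) r]
  field_simp

lemma logTerm_eq_logForm {ν : ℕ} {α z : ℝ} (hα : α < 1) (hz : 0 < z) (r : ℕ)
    (h : ∀ i < r, 1 / (1 - α) ≠ (i : ℝ)) :
    logTerm ν α z r = logForm ν z (1 / (1 - α)) r := by
  have hq : 0 < 1 / (1 - α) := one_div_pos.2 (by linarith)
  have h5 : ((-1 : ℝ) ^ r) * (-1) ^ r = 1 := by rw [← mul_pow]; simp
  rw [logForm_eq hz hq, binomFrac_neg_nat hq r h, logTerm, coeffE, coeffF]
  -- Reflection and index shifts match the arguments of `ψ` with `logForm`; the two factors `(-1)^r`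
  -- in `coeffF` cancel.
  rw [show -(1 / 2) - (ν : ℝ) - r = 1 / 2 - (ν + r + 1 : ℕ) by push_cast; ring, psi_half_sub_nat,
    show 2 + (ν : ℝ) + r = 1 + (ν + r + 1 : ℕ) by push_cast; ring, pow_add (-1 : ℝ) (1 + ν) r,
    mul_left_comm ((-1 : ℝ) ^ r), h5, binomCoeff]
  have hG := (Real.Gamma_pos_of_pos (show 0 < 1 / (1 - α) + 1 by linarith)).ne'
  have h4 := (poch_pos (show (0 : ℝ) < 3 / 2 + ν by positivity) r).ne'
  generalize 1 / (1 - α) = q at *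
  field_simp
  ring

lemma degenerateTerm_eq_logForm {ν N : ℕ} {z : ℝ} (hN : 0 < N) (hz : 0 < z) {r : ℕ} (hr : N < r) :
    degenerateTerm ν N z r = logForm ν z N r := by
  have hq : (0 : ℝ) < N := by exact_mod_cast hN
  obtain ⟨m, rfl⟩ := Nat.exists_eq_add_of_lt hr
  rw [logForm_eq hz hq, binomCoeff_natCast_of_lt hr, Real.Gamma_nat_eq_factorial, degenerateTerm,
    show N + m + 1 = N + 1 + m by ring, binomFrac_natCast_neg_nat hN,
    show N + 1 + m - N - 1 = m by omega]
  have h4 := (poch_pos (show (0 : ℝ) < 3 / 2 + ν by positivity) (N + 1 + m)).ne'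
  field_simp
  ring

lemma continuousAt_logForm {ν : ℕ} {z q : ℝ} (hz : 0 < z) (hq : 0 < q) (r : ℕ) :
    ContinuousAt (fun q => logForm ν z q r) q := by
  have hG := (Real.Gamma_pos_of_pos (show 0 < q + 1 by linarith)).ne'
  have h1 : ContinuousAt (fun q => Real.Gamma (q + 1)) q :=
    (hasDerivAt_Gamma (by linarith : 0 < q + 1)).continuousAt.comp_of_eq (by fun_prop) rfl
  refine ContinuousAt.mul (continuousAt_const.div (h1.mul continuousAt_const)
    (mul_ne_zero hG (by positivity))) (continuousAt_const.mul (ContinuousAt.add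
      ((continuous_binomCoeff r).continuousAt.mul continuousAt_const)
      (continuousAt_binomFrac_neg_nat hq r)))

/-! ### The expansion of the integral over the unit interval -/

lemma exp_neg_mul_rpow_le_one {b : ℝ} (hb : 0 ≤ b) {x : ℝ} (hx : 0 ≤ x) (s : ℝ) :
    Real.exp (-b * x ^ s) ≤ 1 := by
  rw [Real.exp_le_one_iff, neg_mul, neg_nonpos]
  positivity

lemma measurable_integrand (ν : ℕ) (α b : ℝ) : Measurable (integrand ν α b) := by
  unfold integrand
  fun_prop

lemma integrableOn_pow_mul_exp {c : ℝ} (hc : 0 ≤ c) (ν : ℕ) :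
    IntegrableOn (fun t : ℝ => t ^ ν * Real.exp (-c * t ^ (-(1 / 2) : ℝ))) (Ioc 0 1) := by
  refine Measure.integrableOn_of_bounded (M := 1) (by simp)
    (by fun_prop : Measurable _).aestronglyMeasurable
    ((ae_restrict_iff' measurableSet_Ioc).2 (Eventually.of_forall fun t ht => ?_))
  rw [norm_mul, norm_pow, Real.norm_of_nonneg ht.1.le, Real.norm_of_nonneg (Real.exp_pos _).le]
  exact mul_le_one₀ (pow_le_one₀ ht.1.le ht.2) (Real.exp_pos _).le
    (exp_neg_mul_rpow_le_one hc ht.1.le _)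

lemma two_mul_expInt {z : ℝ} (hz : 0 < z) (n : ℕ) :
    2 * expInt (2 * n + 2) (2 * Real.sqrt z) =
      expCoeff (2 * Real.sqrt z) (2 * n + 2) *
        (psi (1 / 2 + (n + 1 : ℕ)) + psi (1 + (n + 1 : ℕ)) - Real.log z) +
      ∑' k : ℕ, expCoeff (2 * Real.sqrt z) k / (n + 1 - k / 2 : ℝ) := by
  have hs : 0 < Real.sqrt z := Real.sqrt_pos.2 hz
  have hψ := psi_two_mul_add_one (n + 1)
  have hlog : 2 * Real.log (2 * Real.sqrt z) = 2 * Real.log 2 + Real.log z := by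
    rw [Real.log_mul two_ne_zero hs.ne', Real.log_sqrt hz.le]
    ring
  have hsum : ∑' k : ℕ, expCoeff (2 * Real.sqrt z) k / (n + 1 - k / 2 : ℝ) =
      -2 * ∑' k : ℕ, expCoeff (2 * Real.sqrt z) k / (k - (2 * n + 2 : ℕ) : ℝ) := by
    rw [← tsum_mul_left]
    refine tsum_congr fun k => ?_
    rw [show (k : ℝ) - (2 * n + 2 : ℕ) = -2 * (n + 1 - k / 2) by push_cast; ring, ← mul_div_assoc,
      mul_div_mul_left _ _ (by norm_num)]
  rw [expInt_eq (by positivity), hsum]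
  rw [show ((2 * n + 2 : ℕ) : ℝ) + 1 = 2 * (n + 1 : ℕ) + 1 by push_cast; ring]
  linear_combination expCoeff (2 * Real.sqrt z) (2 * n + 2) * (hψ - hlog)

/-- The denominators are half-integers, so each nonzero one has absolute value at least `1/2`; hence
the factor `2` in the bound. -/
lemma summable_prod_div_half_int {a e : ℕ → ℝ} (ha : Summable fun j => |a j|)
    (he : Summable fun k => |e k|) (m : ℕ) :
    Summable fun jk : ℕ × ℕ => a jk.1 * (e jk.2 / (m + jk.1 - jk.2 / 2 : ℝ)) := by
  have h := (ha.mul_of_nonneg he (fun _ => abs_nonneg _) (fun _ => abs_nonneg _)).mul_left 2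
  refine h.of_norm_bounded fun ⟨j, k⟩ => ?_
  rw [norm_mul, norm_div, Real.norm_eq_abs, Real.norm_eq_abs, Real.norm_eq_abs]
  rcases eq_or_ne ((m : ℝ) + j - k / 2) 0 with h0 | h0
  · simp only [h0, abs_zero, div_zero, mul_zero]
    positivity
  · have h1 : (1 : ℝ) ≤ |2 * ((m : ℝ) + j - k / 2)| := by
      have h2 : 2 * ((m : ℝ) + j - k / 2) = ((2 * (m + j) - k : ℤ) : ℝ) := by push_cast; ring
      have h3 : (2 * (m + j) - k : ℤ) ≠ 0 := fun h => h0 <| by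
        rw [h, Int.cast_zero] at h2
        linarith
      rw [h2, ← Int.cast_abs]
      exact_mod_cast Int.one_le_abs h3
    rw [abs_mul, abs_two] at h1
    have h4 : |e k| / |(m : ℝ) + j - k / 2| ≤ 2 * |e k| := by
      rw [div_le_iff₀ (abs_pos.2 h0)]
      nlinarith [abs_nonneg (e k)]
    calc |a j| * (|e k| / |(m : ℝ) + j - k / 2|) ≤ |a j| * (2 * |e k|) := by gcongr
      _ = 2 * (|a j| * |e k|) := by ring

lemma tsum_odd_eq_hyp {p z : ℝ} (hp : 0 < p) (hz : 0 < z) (ν r : ℕ) :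
    expCoeff (2 * Real.sqrt z) (2 * r + 1) * binomFrac p (ν + 1 - (2 * r + 1 : ℕ) / 2) =
      -(Real.Gamma (p + 1) / Real.sqrt Real.pi) *
        (2 * Real.sqrt Real.pi * Real.Gamma (1 / 2 + ν) / Real.Gamma (3 / 2 + ν + p) *
          Real.sqrt z * hyp12Term (-(1 / 2) - ν - p) (3 / 2) (1 / 2 - ν) z r) := by
  have h1 := binomFrac_sub_nat hp (x := 1 / 2 + ν) r fun i _ j h => by
    have h2 : (1 : ℝ) + 2 * ν + 2 * j = 2 * (i + 1) := by linarith
    norm_cast at h2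
    omega
  rw [binomFrac_of_pos (x := 1 / 2 + (ν : ℝ)) (by positivity) hp] at h1
  have hpi : Real.sqrt Real.pi ≠ 0 := (Real.sqrt_pos.2 Real.pi_pos).ne'
  rw [expCoeff_two_mul_add_one hz.le,
    show (ν : ℝ) + 1 - (2 * r + 1 : ℕ) / 2 = 1 / 2 + ν - r by push_cast; ring, h1, hyp12Term,
    show -(1 / 2 + (ν : ℝ)) - p = -(1 / 2) - ν - p by ring,
    show 1 - (1 / 2 + (ν : ℝ)) = 1 / 2 - ν by ring,
    show 1 / 2 + (ν : ℝ) + p + 1 = 3 / 2 + ν + p by ring]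
  field_simp

lemma even_term_eq_finite {p z : ℝ} (hp : 0 < p) (hz : 0 < z) {ν r : ℕ} (hr : r ≤ ν) :
    expCoeff (2 * Real.sqrt z) (2 * r) * binomFrac p (ν + 1 - (2 * r : ℕ) / 2) =
      Real.Gamma (p + 1) / Real.sqrt Real.pi *
        (Real.sqrt Real.pi * Real.Gamma (1 + ν) / Real.Gamma (2 + ν + p) *
          (poch (-1 - ν - p) r / (poch (1 / 2) r * poch (-ν) r * r.factorial) * z ^ r)) := by
  have h1 := binomFrac_sub_nat hp (x := 1 + ν) r fun i hi j h => by
    have h2 : (ν : ℝ) + j = i := by linarith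
    norm_cast at h2
    omega
  rw [binomFrac_of_pos (x := 1 + (ν : ℝ)) (by positivity) hp] at h1
  have hpi : Real.sqrt Real.pi ≠ 0 := (Real.sqrt_pos.2 Real.pi_pos).ne'
  rw [expCoeff_two_mul hz.le,
    show (ν : ℝ) + 1 - (2 * r : ℕ) / 2 = 1 + ν - r by push_cast; ring, h1,
    show -(1 + (ν : ℝ)) - p = -1 - ν - p by ring,
    show 1 - (1 + (ν : ℝ)) = -ν by ring,
    show 1 + (ν : ℝ) + p + 1 = 2 + ν + p by ring]
  field_simp

/-- The interchange of summations: integrating the binomial series termwise gives the logarithmic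
terms plus the double sum, which Fubini reorders into a single series over `k`. -/
lemma hasSum_log_part {p z : ℝ} (hp : 0 < p) (hz : 0 < z) (ν : ℕ) :
    Summable (fun k : ℕ => expCoeff (2 * Real.sqrt z) k * binomFrac p (ν + 1 - k / 2)) ∧
    HasSum (fun j : ℕ => binomCoeff p j * (expCoeff (2 * Real.sqrt z) (2 * (ν + j) + 2) *
      (psi (1 / 2 + (ν + j + 1 : ℕ)) + psi (1 + (ν + j + 1 : ℕ)) - Real.log z)))
      ((∫ t in Ioc (0 : ℝ) 1, (1 - t) ^ p *
        (t ^ ν * Real.exp (-(2 * Real.sqrt z) * t ^ (-(1 / 2) : ℝ)))) -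
        ∑' k : ℕ, expCoeff (2 * Real.sqrt z) k * binomFrac p (ν + 1 - k / 2)) := by
  have hs : 0 < Real.sqrt z := Real.sqrt_pos.2 hz
  have hterm : ∀ j : ℕ, ∫ t in Ioc (0 : ℝ) 1,
      t ^ j * (t ^ ν * Real.exp (-(2 * Real.sqrt z) * t ^ (-(1 / 2) : ℝ))) =
      expCoeff (2 * Real.sqrt z) (2 * (ν + j) + 2) *
        (psi (1 / 2 + (ν + j + 1 : ℕ)) + psi (1 + (ν + j + 1 : ℕ)) - Real.log z) +
      ∑' k : ℕ, expCoeff (2 * Real.sqrt z) k / ((ν + j : ℕ) + 1 - k / 2 : ℝ) := fun j => by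
    rw [← two_mul_expInt hz, ← integral_pow_mul_exp_neg_rpow]
    refine setIntegral_congr_fun measurableSet_Ioc fun t _ => ?_
    rw [pow_add, mul_left_comm, mul_assoc]
  have hc0 : 0 < 2 * Real.sqrt z := by positivity
  generalize 2 * Real.sqrt z = c at *
  have ha := summable_abs_binomCoeff hp
  have he := summable_abs_expCoeff c
  have hD := summable_prod_div_half_int ha he (ν + 1)
  have hDsymm := hD.prod_symm
  have hj : ∀ j : ℕ, ∑' k : ℕ, binomCoeff p j * (expCoeff c k / ((ν + 1 : ℕ) + j - k / 2 : ℝ)) =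
      binomCoeff p j * ∑' k : ℕ, expCoeff c k / ((ν + j : ℕ) + 1 - k / 2 : ℝ) := fun j => by
    rw [tsum_mul_left]
    congr 1
    refine tsum_congr fun k => ?_
    congr 1
    push_cast
    ring
  have hk : ∀ k : ℕ, ∑' j : ℕ, binomCoeff p j * (expCoeff c k / ((ν + 1 : ℕ) + j - k / 2 : ℝ)) =
      expCoeff c k * binomFrac p (ν + 1 - k / 2) := fun k => by
    rw [binomFrac, ← tsum_mul_left]
    refine tsum_congr fun j => ?_
    rw [show (ν : ℝ) + 1 - k / 2 + j = (ν + 1 : ℕ) + j - k / 2 by push_cast; ring]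
    ring
  have hsj : Summable fun j => binomCoeff p j *
      ∑' k : ℕ, expCoeff c k / ((ν + j : ℕ) + 1 - k / 2 : ℝ) := hD.prod.congr hj
  have hsk : Summable fun k : ℕ => expCoeff c k * binomFrac p (ν + 1 - k / 2) :=
    hDsymm.prod.congr hk
  have hswap : ∑' j, binomCoeff p j * ∑' k : ℕ, expCoeff c k / ((ν + j : ℕ) + 1 - k / 2 : ℝ) =
      ∑' k : ℕ, expCoeff c k * binomFrac p (ν + 1 - k / 2) := by
    rw [← tsum_congr hj, ← tsum_congr hk]
    exact (Summable.tsum_comm (f := fun j k : ℕ => binomCoeff p j *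
      (expCoeff c k / ((ν + 1 : ℕ) + j - k / 2 : ℝ))) hD).symm
  have hJ := hasSum_integral_tsum_mul_pow ha (integrableOn_pow_mul_exp hc0.le ν)
  have hint : ∫ t in Ioc (0 : ℝ) 1, (1 - t) ^ p *
        (t ^ ν * Real.exp (-c * t ^ (-(1 / 2) : ℝ))) =
      ∫ t in Ioc (0 : ℝ) 1, (∑' j, binomCoeff p j * t ^ j) *
        (t ^ ν * Real.exp (-c * t ^ (-(1 / 2) : ℝ))) :=
    setIntegral_congr_fun measurableSet_Ioc fun t ht => by
      simp only [tsum_binomCoeff_mul_pow hp ⟨ht.1.le, ht.2⟩]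
  rw [← hint] at hJ
  simp only [hterm, mul_add] at hJ
  refine ⟨hsk, ?_⟩
  rw [← hswap]
  refine (hJ.sub hsj.hasSum).congr_fun fun j => ?_
  ring_nf

lemma tsum_eq_sum_even_add_tsum_even_add_tsum_odd {f : ℕ → ℝ} (hf : Summable f) (m : ℕ) :
    ∑' k, f k = ∑ r ∈ Finset.range m, f (2 * r) + ∑' r, f (2 * (r + m)) +
      ∑' r, f (2 * r + 1) := by
  have heven : Summable fun r => f (2 * r) :=
    hf.comp_injective (i := fun r => 2 * r) fun _ _ h => by simpa using h
  have hodd : Summable fun r => f (2 * r + 1) :=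
    hf.comp_injective (i := fun r => 2 * r + 1) fun _ _ h => by simpa using h
  rw [← tsum_even_add_odd heven hodd, ← heven.sum_add_tsum_nat_add m]

lemma even_term_eq_tail (c p : ℝ) (ν r : ℕ) :
    expCoeff c (2 * (r + (ν + 1))) * binomFrac p (ν + 1 - (2 * (r + (ν + 1)) : ℕ) / 2) =
      expCoeff c (2 * (ν + r) + 2) * binomFrac p (-(r : ℝ)) := by
  rw [show 2 * (r + (ν + 1)) = 2 * (ν + r) + 2 by ring]
  congr 2
  push_cast
  ring

/-- `logForm` collects the logarithmic terms and the part of the `k`-series with `k = 2(ν + 1 + r)`,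
hence the tail is added back. -/
lemma hasSum_logForm {p z : ℝ} (hp : 0 < p) (hz : 0 < z) (ν : ℕ) :
    HasSum (logForm ν z p) (Real.sqrt Real.pi / (Real.Gamma (p + 1) * z ^ (1 + ν)) *
      ((∫ t in Ioc (0 : ℝ) 1, (1 - t) ^ p *
        (t ^ ν * Real.exp (-(2 * Real.sqrt z) * t ^ (-(1 / 2) : ℝ)))) -
        (∑' k : ℕ, expCoeff (2 * Real.sqrt z) k * binomFrac p (ν + 1 - k / 2)) +
        ∑' r : ℕ, expCoeff (2 * Real.sqrt z) (2 * (ν + r) + 2) * binomFrac p (-(r : ℝ)))) := by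
  obtain ⟨hsk, hX⟩ := hasSum_log_part hp hz ν
  have htail : Summable fun r : ℕ =>
      expCoeff (2 * Real.sqrt z) (2 * (ν + r) + 2) * binomFrac p (-(r : ℝ)) := by
    have h := hsk.comp_injective (i := fun r => 2 * (r + (ν + 1))) fun _ _ h => by simpa using h
    exact h.congr fun r => (even_term_eq_tail _ p ν r)
  refine ((hX.add htail.hasSum).mul_left _).congr_fun fun r => ?_
  rw [logForm]
  ring

lemma summable_hyp12Term {p z : ℝ} (hp : 0 < p) (hz : 0 < z) (ν : ℕ) :
    Summable (hyp12Term (-(1 / 2) - ν - p) (3 / 2) (1 / 2 - ν) z) := by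
  have hs : 0 < Real.sqrt z := Real.sqrt_pos.2 hz
  have hpi : 0 < Real.sqrt Real.pi := Real.sqrt_pos.2 Real.pi_pos
  have hG := Real.Gamma_pos_of_pos (show 0 < p + 1 by linarith)
  have h1 := Real.Gamma_pos_of_pos (show (0 : ℝ) < 1 / 2 + ν by positivity)
  have h2 := Real.Gamma_pos_of_pos (show (0 : ℝ) < 3 / 2 + ν + p by positivity)
  have hK : 2 * Real.sqrt Real.pi * Real.Gamma (1 / 2 + ν) / Real.Gamma (3 / 2 + ν + p) *
      Real.sqrt z ≠ 0 := by positivity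
  have hC : -(Real.Gamma (p + 1) / Real.sqrt Real.pi) ≠ 0 := neg_ne_zero.2 (by positivity)
  rw [← summable_mul_left_iff hK, ← summable_mul_left_iff hC]
  have h := (hasSum_log_part hp hz ν).1.comp_injective (i := fun r => 2 * r + 1)
    fun _ _ h => by simpa using h
  exact h.congr fun r => tsum_odd_eq_hyp hp hz ν r

lemma tsum_expCoeff_mul_binomFrac {p z : ℝ} (hp : 0 < p) (hz : 0 < z) (ν : ℕ) :
    ∑' k : ℕ, expCoeff (2 * Real.sqrt z) k * binomFrac p (ν + 1 - k / 2) =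
      Real.Gamma (p + 1) / Real.sqrt Real.pi *
        (Real.sqrt Real.pi * Real.Gamma (1 + ν) / Real.Gamma (2 + ν + p) *
          ∑ r ∈ Finset.range (ν + 1),
            poch (-1 - ν - p) r / (poch (1 / 2) r * poch (-ν) r * r.factorial) * z ^ r) +
      ∑' r : ℕ, expCoeff (2 * Real.sqrt z) (2 * (ν + r) + 2) * binomFrac p (-(r : ℝ)) +
      -(Real.Gamma (p + 1) / Real.sqrt Real.pi) *
        (2 * Real.sqrt Real.pi * Real.Gamma (1 / 2 + ν) / Real.Gamma (3 / 2 + ν + p) *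
          Real.sqrt z * hyp12 (-(1 / 2) - ν - p) (3 / 2) (1 / 2 - ν) z) := by
  rw [tsum_eq_sum_even_add_tsum_even_add_tsum_odd (hasSum_log_part hp hz ν).1 (ν + 1),
    tsum_congr (even_term_eq_tail _ p ν), tsum_congr (tsum_odd_eq_hyp hp hz ν), tsum_mul_left,
    tsum_mul_left, ← hyp12, Finset.sum_congr rfl fun r hr =>
      even_term_eq_finite hp hz (Nat.lt_succ_iff.1 (Finset.mem_range.1 hr)),
    ← Finset.mul_sum, ← Finset.mul_sum]

lemma integral_unit_interval_eq {p z : ℝ} (hp : 0 < p) (hz : 0 < z) (ν : ℕ) :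
    ∫ t in Ioc (0 : ℝ) 1, (1 - t) ^ p *
        (t ^ ν * Real.exp (-(2 * Real.sqrt z) * t ^ (-(1 / 2) : ℝ))) =
      Real.Gamma (p + 1) / Real.sqrt Real.pi *
        (Real.sqrt Real.pi * Real.Gamma (1 + ν) / Real.Gamma (2 + ν + p) *
            ∑ r ∈ Finset.range (ν + 1),
              poch (-1 - ν - p) r / (poch (1 / 2) r * poch (-ν) r * r.factorial) * z ^ r -
          2 * Real.sqrt Real.pi * Real.Gamma (1 / 2 + ν) / Real.Gamma (3 / 2 + ν + p) *
            Real.sqrt z * hyp12 (-(1 / 2) - ν - p) (3 / 2) (1 / 2 - ν) z +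
          z ^ (1 + ν) * ∑' r, logForm ν z p r) := by
  have hpi : Real.sqrt Real.pi ≠ 0 := (Real.sqrt_pos.2 Real.pi_pos).ne'
  have hG := (Real.Gamma_pos_of_pos (show 0 < p + 1 by linarith)).ne'
  have hzn : z ^ (1 + ν) ≠ 0 := by positivity
  rw [(hasSum_logForm hp hz ν).tsum_eq, tsum_expCoeff_mul_binomFrac hp hz ν]
  generalize ∫ t in Ioc (0 : ℝ) 1, (1 - t) ^ p *
    (t ^ ν * Real.exp (-(2 * Real.sqrt z) * t ^ (-(1 / 2) : ℝ))) = J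
  generalize ∑' r : ℕ, expCoeff (2 * Real.sqrt z) (2 * (ν + r) + 2) * binomFrac p (-(r : ℝ)) = T
  have h : Real.Gamma (p + 1) / Real.sqrt Real.pi * (z ^ (1 + ν) *
      (Real.sqrt Real.pi / (Real.Gamma (p + 1) * z ^ (1 + ν)))) = 1 := by field_simp
  -- The tails `T` cancel, and what remains is `h`, the cancellation of the constants, multiplied by
  -- the value of the logarithmic series before normalization.
  linear_combination (-1 : ℝ) * (J - (Real.Gamma (p + 1) / Real.sqrt Real.pi *
        (Real.sqrt Real.pi * Real.Gamma (1 + ν) / Real.Gamma (2 + ν + p) *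
          ∑ r ∈ Finset.range (ν + 1),
            poch (-1 - ν - p) r / (poch (1 / 2) r * poch (-ν) r * r.factorial) * z ^ r) + T +
      -(Real.Gamma (p + 1) / Real.sqrt Real.pi) *
        (2 * Real.sqrt Real.pi * Real.Gamma (1 / 2 + ν) / Real.Gamma (3 / 2 + ν + p) *
          Real.sqrt z * hyp12 (-(1 / 2) - ν - p) (3 / 2) (1 / 2 - ν) z)) + T) * h

/-! ### The cut-off integral -/

lemma intervalIntegrable_integrand {ν : ℕ} {α b : ℝ} (hα : α < 1) (hb : 0 < b) :
    IntervalIntegrable (integrand ν α b) volume 0 (1 / (1 - α)) := by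
  have h1 : 0 < 1 - α := by linarith
  have hd : 0 < 1 / (1 - α) := one_div_pos.2 h1
  rw [intervalIntegrable_iff_integrableOn_Ioc_of_le hd.le]
  refine Measure.integrableOn_of_bounded (M := (1 / (1 - α)) ^ ν) (by simp)
    (measurable_integrand ν α b).aestronglyMeasurable
    ((ae_restrict_iff' measurableSet_Ioc).2 (Eventually.of_forall fun x hx => ?_))
  have h2 : (1 - α) * x ≤ 1 := by
    have := hx.2
    rw [le_div_iff₀ h1] at this
    linarith
  have h3 : 0 ≤ (1 - α) * x := mul_nonneg h1.le hx.1.le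
  rw [integrand, norm_mul, norm_mul, norm_pow, Real.norm_of_nonneg hx.1.le,
    Real.norm_of_nonneg (Real.exp_pos _).le,
    Real.norm_of_nonneg (Real.rpow_nonneg (by linarith) _), mul_assoc]
  calc x ^ ν * ((1 - (1 - α) * x) ^ (1 / (1 - α)) * Real.exp (-b * x ^ (-(1 / 2) : ℝ)))
      ≤ (1 / (1 - α)) ^ ν * 1 := by
        have h4 := hx.1.le
        gcongr
        · exact hx.2
        · exact mul_le_one₀ (Real.rpow_le_one (by linarith) (by linarith) hd.le)
            (Real.exp_pos _).le (exp_neg_mul_rpow_le_one hb.le h4 _)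
    _ = _ := mul_one _

lemma zArg_pos {α b : ℝ} (hα : α < 1) (hb : 0 < b) : 0 < zArg α b := by
  have h1 : 0 < 1 - α := by linarith
  rw [zArg]
  positivity

lemma cutoffIntegral_eq {ν : ℕ} {α b : ℝ} (hα : α < 1) (hb : 0 < b) :
    cutoffIntegral ν α b = (1 / (1 - α)) ^ (ν + 1) *
      ∫ t in Ioc (0 : ℝ) 1, (1 - t) ^ (1 / (1 - α)) *
        (t ^ ν * Real.exp (-(2 * Real.sqrt (zArg α b)) * t ^ (-(1 / 2) : ℝ))) := by
  have h1 : 0 < 1 - α := by linarith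
  have hd : 0 < 1 / (1 - α) := one_div_pos.2 h1
  have h := intervalIntegral.smul_integral_comp_mul_left (a := 0) (b := 1) (integrand ν α b)
    (1 / (1 - α))
  rw [mul_zero, mul_one] at h
  rw [cutoffIntegral, ← h, intervalIntegral.integral_of_le zero_le_one, smul_eq_mul, pow_succ',
    mul_assoc, ← integral_const_mul ((1 / (1 - α)) ^ ν)]
  congr 1
  refine setIntegral_congr_fun measurableSet_Ioc fun t ht => ?_
  have hs : 2 * Real.sqrt (zArg α b) = b * (1 / (1 - α)) ^ (-(1 / 2) : ℝ) := by
    rw [zArg, show (1 - α) * b ^ 2 / 4 = (1 - α) * (b / 2) ^ 2 by ring,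
      Real.sqrt_mul h1.le, Real.sqrt_sq (by positivity), Real.sqrt_eq_rpow, one_div (1 - α),
      Real.inv_rpow h1.le, Real.rpow_neg h1.le, inv_inv]
    ring
  have hcancel : (1 - α) * (1 / (1 - α) * t) = t := by field_simp
  simp only [integrand]
  rw [hcancel, Real.mul_rpow hd.le ht.1.le, hs, mul_pow]
  ring_nf

lemma cutoffIntegral_eq_logForm {ν : ℕ} {α b : ℝ} (hα : α < 1) (hb : 0 < b) :
    cutoffIntegral ν α b = prefactor ν α *
      (finitePart ν α (zArg α b) - hypPart ν α (zArg α b) +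
        zArg α b ^ (1 + ν) * ∑' r : ℕ, logForm ν (zArg α b) (1 / (1 - α)) r) := by
  have h1 : 0 < 1 - α := by linarith
  rw [cutoffIntegral_eq hα hb,
    integral_unit_interval_eq (one_div_pos.2 h1) (zArg_pos hα hb) ν, prefactor, finitePart,
    hypPart, ← mul_assoc]
  congr 1
  rw [one_div_pow]
  field_simp

lemma tendsto_logTerm {ν N r : ℕ} {α z : ℝ} (hα : α < 1) (hz : 0 < z)
    (hN : 1 / (1 - α) = (N : ℝ)) (hr : N < r) :
    Tendsto (fun β : ℝ => (-Real.log z + coeffE ν β r) * coeffF ν β r * z ^ r)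
      (𝓝[{α}ᶜ] α) (𝓝 (degenerateTerm ν N z r)) := by
  have h1 : 0 < 1 - α := by linarith
  have hd : 0 < 1 / (1 - α) := one_div_pos.2 h1
  have hN0 : 0 < N := by
    rw [hN] at hd
    exact_mod_cast hd
  have hcont : ContinuousAt (fun β : ℝ => 1 / (1 - β)) α :=
    continuousAt_const.div (by fun_prop) h1.ne'
  have hlim : Tendsto (fun β : ℝ => logForm ν z (1 / (1 - β)) r) (𝓝[{α}ᶜ] α)
      (𝓝 (degenerateTerm ν N z r)) := by
    rw [degenerateTerm_eq_logForm hN0 hz hr, ← hN]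
    exact (((continuousAt_logForm hz hd r).comp_of_eq hcont rfl).tendsto).mono_left
      nhdsWithin_le_nhds
  refine hlim.congr' ?_
  -- The only natural number in `(N - 1, N + 1)` is `N`, and `1 / (1 - β) = N` forces `β = α`; so
  -- nearby `β ≠ α` fall under the non-degenerate formula.
  have hnear : ∀ᶠ β in 𝓝[{α}ᶜ] α, 1 / (1 - β) ∈ Ioo ((N : ℝ) - 1) (N + 1) :=
    nhdsWithin_le_nhds (hcont.eventually (Ioo_mem_nhds (by simp only [hN]; linarith)
      (by simp only [hN]; linarith)))
  have hlt : ∀ᶠ β in 𝓝[{α}ᶜ] α, β < 1 := nhdsWithin_le_nhds (gt_mem_nhds hα)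
  filter_upwards [hnear, hlt, self_mem_nhdsWithin] with β hβ hβ1 hne
  rw [← logTerm_eq_logForm hβ1 hz r fun i _ hi => hne ?_, logTerm]
  · ring
  · rw [hi] at hβ
    have h2 : (N : ℝ) < i + 1 := by linarith [hβ.1]
    have h3 : N < i + 1 := by exact_mod_cast h2
    have h4 : i < N + 1 := by exact_mod_cast hβ.2
    have h5 : i = N := by omega
    rw [h5, ← hN, one_div, one_div, inv_inj] at hi
    exact mem_singleton_iff.2 (by linarith)

end CutoffThermonuclear

end

theorem mainTheorem7 (ν : ℕ) (hν : 0 < ν) (b α : ℝ) (hb : 0 < b) (hα : α < 1) :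
    IntervalIntegrable (CutoffThermonuclear.integrand ν α b) MeasureTheory.volume
      0 (1 / (1 - α)) ∧
    Summable (CutoffThermonuclear.hyp12Term (-(1 / 2) - (ν : ℝ) - 1 / (1 - α)) (3 / 2)
      (1 / 2 - (ν : ℝ)) (CutoffThermonuclear.zArg α b)) ∧
    ((∀ N : ℕ, 1 / (1 - α) ≠ (N : ℝ)) →
      Summable (CutoffThermonuclear.logTerm ν α (CutoffThermonuclear.zArg α b)) ∧
      CutoffThermonuclear.cutoffIntegral ν α b =
        CutoffThermonuclear.prefactor ν α *
          (CutoffThermonuclear.finitePart ν α (CutoffThermonuclear.zArg α b) -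
            CutoffThermonuclear.hypPart ν α (CutoffThermonuclear.zArg α b) +
            CutoffThermonuclear.zArg α b ^ (1 + ν) *
              ∑' r : ℕ, CutoffThermonuclear.logTerm ν α (CutoffThermonuclear.zArg α b) r)) ∧
    (∀ N : ℕ, 1 / (1 - α) = (N : ℝ) →
      (∀ r : ℕ, N < r →
        Filter.Tendsto
          (fun β : ℝ =>
            (-Real.log (CutoffThermonuclear.zArg α b) + CutoffThermonuclear.coeffE ν β r) *
              CutoffThermonuclear.coeffF ν β r * CutoffThermonuclear.zArg α b ^ r)
          (nhdsWithin α {α}ᶜ)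
          (nhds (CutoffThermonuclear.degenerateTerm ν N (CutoffThermonuclear.zArg α b) r))) ∧
      Summable (CutoffThermonuclear.logTermInt ν N α (CutoffThermonuclear.zArg α b)) ∧
      CutoffThermonuclear.cutoffIntegral ν α b =
        CutoffThermonuclear.prefactor ν α *
          (CutoffThermonuclear.finitePart ν α (CutoffThermonuclear.zArg α b) -
            CutoffThermonuclear.hypPart ν α (CutoffThermonuclear.zArg α b) +
            CutoffThermonuclear.zArg α b ^ (1 + ν) *
              ∑' r : ℕ, CutoffThermonuclear.logTermInt ν N α (CutoffThermonuclear.zArg α b) r))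
    := by
  have hz := CutoffThermonuclear.zArg_pos hα hb
  have hd : 0 < 1 / (1 - α) := one_div_pos.2 (by linarith)
  have hhyp := CutoffThermonuclear.summable_hyp12Term hd hz ν
  have hlog := (CutoffThermonuclear.hasSum_logForm hd hz ν).summable
  have hI := CutoffThermonuclear.cutoffIntegral_eq_logForm (ν := ν) hα hb
  refine ⟨CutoffThermonuclear.intervalIntegrable_integrand hα hb, hhyp, fun hne => ?_,
    fun N hN => ⟨fun r hr => CutoffThermonuclear.tendsto_logTerm hα hz hN hr, ?_⟩⟩
  · have h : CutoffThermonuclear.logTerm ν α (CutoffThermonuclear.zArg α b) =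
        CutoffThermonuclear.logForm ν (CutoffThermonuclear.zArg α b) (1 / (1 - α)) :=
      funext fun r => CutoffThermonuclear.logTerm_eq_logForm hα hz r fun i _ => hne i
    rw [h]
    exact ⟨hlog, hI⟩
  · have hN0 : 0 < N := by
      rw [hN] at hd
      exact_mod_cast hd
    have h : CutoffThermonuclear.logTermInt ν N α (CutoffThermonuclear.zArg α b) =
        CutoffThermonuclear.logForm ν (CutoffThermonuclear.zArg α b) (1 / (1 - α)) := by
      funext r
      rw [CutoffThermonuclear.logTermInt]
      split_ifs with hr
      -- For `r ≤ N` only the values `i < r` must be avoided, and `N` is not among them.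
      · refine CutoffThermonuclear.logTerm_eq_logForm hα hz r fun i hi h => ?_
        rw [hN, Nat.cast_inj] at h
        omega
      · rw [CutoffThermonuclear.degenerateTerm_eq_logForm hN0 hz (not_le.1 hr), hN]
    rw [h]
    exact ⟨hlog, hI⟩
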